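/- **Setting.** A metric graph $\mathcal G$ has finitely many vertices, finitely many bounded edges (each identified with an interval $I_e=[0,\ell_e]$, $0<\ell_e<\infty$; self-loops and multiple edges are allowed) and finitely many halflines (each identified with $I_e=[0,+\infty)$, starting at a vertex and ending at its own vertex at infinity). $\mathcal G$ is assumed to be connected and noncompact, i.e. to have at least one halfline. $H^1(\mathcal G)$ is the set of continuous functions $u=(u_e)_e:\mathcal G\to\mathbb C$ with $u_e\in H^1(I_e)$ for every edge or halfline $e$, and norms on $\mathcal G$ are computed edge by edge, $\|u\|_{L^p(\mathcal G)}^p=\sum_e\|u_e\|_{L^p(I_e)}^p$. For $\mu>0$ let $H^1_\mu(\mathcal G)=\{u\in H^1(\mathcal G):\|u\|_{L^2(\mathcal G)}^2=\mu\}$, and for the exponent $p=6$ let $$E(u,\mathcal G)=\tfrac12\|u'\|_{L^2(\mathcal G)}^2-\tfrac16\|u\|_{L^6(\mathcal G)}^6,\qquad \mathcal E_{\mathcal G}(\mu)=\inf_{u\in H^1_\mu(\mathcal G)}E(u,\mathcal G)\in[-\infty,+\infty).$$ Let $$K_{\mathcal G}=\sup_{u\in H^1(\mathcal G),\,u\not\equiv0}\frac{\|u\|_{L^6(\mathcal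 G)}^6}{\|u\|_{L^2(\mathcal G)}^4\,\|u'\|_{L^2(\mathcal G)}^2}$$ be the best constant in the Gagliardo–Nirenberg inequality on $\mathcal G$, let $\mu_{\mathcal G}=\sqrt{3/K_{\mathcal G}}$ be the critical mass of $\mathcal G$, and let $\mu_{\mathbb R}$ be the critical mass of the real line (the graph made of two halflines attached at one vertex). A tower of bubbles is a metric graph isometric to the real line with $x_j$ identified with $-x_j$ for $j=1,\dots,n$, for some $n\ge1$ and some $0<x_1<\dots<x_n$. Assumption (H): after identifying all the vertices at infinity with one another, the graph admits a cycle covering, i.e. every bounded edge and every halfline belongs to a cycle (a self-loop and a pair of parallel edges count as cycles). **Theorem 7.2 (Case 2).** Assume that the connected noncompact metric graph $\mathcal G$ satisfies Assumption (H). Then * $\mu_{\mathcal G}=\mu_{\mathbb R}$; * $\mathcal E_{\mathcal G}(\mu_{\mathbb R})=0$, and this infimum is attained by some $u\in H^1_{\mu_{\mathbb R}}(\mathcal G)$ if and only if $\mathcal G$ is isometric to $\mathbb R$ or is a tower of bubbles. -/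

import Mathlib

open MeasureTheory Set
open scoped ContDiff

noncomputable section

/-- A metric graph with finitely many vertices `V`, bounded edges `E` and halflines `H` (finiteness
is imposed by instance arguments). A bounded edge `e` is a copy of `[0, len e]`, its endpoints `0`
and `len e` being attached at `src e` and `tgt e`; self-loops and multiple edges are allowed.
A halfline `h` is a copy of `[0, ∞)`, its endpoint `0` being attached at the vertex `base h`.
The other end of each halfline is a vertex at infinity of degree one, so that the vertices at
infinity are in bijection with `H` and need no separate name. -/
structure MetricGraph (V E H : Type*) where
  src : E → V
  tgt : E → V
  len : E → ℝ
  len_pos : ∀ e, 0 < len e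
  base : H → V

/-- `g` is a weak derivative of `f` in the interior of the interval `I`, tested against real smooth
functions with compact support in the interior of `I`. -/
def HasWeakDerivOn (I : Set ℝ) (f g : ℝ → ℂ) : Prop :=
  ∀ φ : ℝ → ℝ, ContDiff ℝ ∞ φ → HasCompactSupport φ → tsupport φ ⊆ interior I →
    ∫ x in I, deriv φ x • f x = -∫ x in I, φ x • g x

namespace MetricGraph

variable {V E H : Type*}

/-- The interval `I_e` that parametrizes the edge `e` (a bounded edge or a halfline). -/
def interval (G : MetricGraph V E H) : E ⊕ H → Set ℝ
  | .inl e => Icc 0 (G.len e)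
  | .inr _ => Ici 0

/-- The point with coordinate `t` of the edge `e` is the vertex `v`. -/
def IsEnd (G : MetricGraph V E H) : E ⊕ H → ℝ → V → Prop
  | .inl e, t, v => (t = 0 ∧ v = G.src e) ∨ (t = G.len e ∧ v = G.tgt e)
  | .inr h, t, v => t = 0 ∧ v = G.base h

/-- The graph is connected: any two vertices are joined by a chain of bounded edges. -/
def Connected (G : MetricGraph V E H) : Prop :=
  ∀ v w : V, Relation.EqvGen (fun a b => ∃ e, G.src e = a ∧ G.tgt e = b) v w

/-! ### Cycle coverings -/

/-- `G.Joins c a b`: the edge `c` joins `a` and `b` in the multigraph obtained from `G` by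
identifying all the vertices at infinity to the single vertex `none`. -/
def Joins (G : MetricGraph V E H) : E ⊕ H → Option V → Option V → Prop
  | .inl e, a, b => (a = some (G.src e) ∧ b = some (G.tgt e)) ∨
      (a = some (G.tgt e) ∧ b = some (G.src e))
  | .inr h, a, b => (a = some (G.base h) ∧ b = none) ∨ (a = none ∧ b = some (G.base h))

/-- A cycle of length `n ≥ 1` in the multigraph obtained by identifying all the vertices at
infinity: `n` distinct vertices `v i` and `n` distinct edges `c i`, indexed cyclically, such that
`c i` joins `v i` and `v (i + 1)`. A self-loop is a cycle of length one. -/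
def IsCycle (G : MetricGraph V E H) (n : ℕ) (v : ZMod n → Option V) (c : ZMod n → E ⊕ H) : Prop :=
  1 ≤ n ∧ Function.Injective v ∧ Function.Injective c ∧ ∀ i, G.Joins (c i) (v i) (v (i + 1))

/-- Assumption (H): after identifying all the vertices at infinity, the graph admits a cycle
covering, i.e. each edge (bounded edge or halfline) belongs to a cycle. -/
def HasCycleCovering (G : MetricGraph V E H) : Prop :=
  ∀ e : E ⊕ H, ∃ (n : ℕ) (v : ZMod n → Option V) (c : ZMod n → E ⊕ H),
    G.IsCycle n v c ∧ e ∈ range c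

/-! ### The space `H¹(𝒢)`, the energy and the critical mass -/

/-- An element of `H¹(𝒢)`: a family of continuous functions `u_e : I_e → ℂ` that agree at the
vertices, each lying in `L²(I_e)` and having a weak derivative in `L²(I_e)`. The weak derivative,
which is unique almost everywhere on `I_e`, is recorded as a component. Only the values of
`toFun e` and `weakDeriv e` on `I_e` matter. -/
structure H1 (G : MetricGraph V E H) where
  toFun : E ⊕ H → ℝ → ℂ
  weakDeriv : E ⊕ H → ℝ → ℂ
  continuousOn : ∀ e, ContinuousOn (toFun e) (G.interval e)
  continuous_vertex : ∃ val : V → ℂ, ∀ e t v, G.IsEnd e t v → toFun e t = val v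
  memLp : ∀ e, MemLp (toFun e) 2 (volume.restrict (G.interval e))
  memLp_weakDeriv : ∀ e, MemLp (weakDeriv e) 2 (volume.restrict (G.interval e))
  hasWeakDerivOn : ∀ e, HasWeakDerivOn (G.interval e) (toFun e) (weakDeriv e)

variable [Fintype E] [Fintype H]

/-- The integral of a function over the graph. -/
def integral (G : MetricGraph V E H) (f : E ⊕ H → ℝ → ℝ) : ℝ :=
  ∑ e, ∫ x in G.interval e, f e x

/-- The mass `‖u‖²` in `L²(𝒢)`. -/
def mass (G : MetricGraph V E H) (u : G.H1) : ℝ :=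
  G.integral fun e x => ‖u.toFun e x‖ ^ 2

/-- `‖u'‖²` in `L²(𝒢)`. -/
def kinetic (G : MetricGraph V E H) (u : G.H1) : ℝ :=
  G.integral fun e x => ‖u.weakDeriv e x‖ ^ 2

/-- `‖u‖⁶` in `L⁶(𝒢)` (finite for each `u` in `H¹(𝒢)`, which is bounded). -/
def sextic (G : MetricGraph V E H) (u : G.H1) : ℝ :=
  G.integral fun e x => ‖u.toFun e x‖ ^ 6

/-- The critical NLS energy functional (exponent `p = 6`). -/
def energy (G : MetricGraph V E H) (u : G.H1) : ℝ :=
  1 / 2 * G.kinetic u - 1 / 6 * G.sextic u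

/-- The ground state energy level: the infimum of the energy, as an extended real number, over the
functions in `H¹(𝒢)` of mass `μ`. -/
def groundEnergy (G : MetricGraph V E H) (μ : ℝ) : EReal :=
  ⨅ u : {u : G.H1 // G.mass u = μ}, (G.energy u.1 : EReal)

/-- `u` is a ground state of mass `μ`. -/
def IsGroundState (G : MetricGraph V E H) (μ : ℝ) (u : G.H1) : Prop :=
  G.mass u = μ ∧ (G.energy u : EReal) = G.groundEnergy μ

/-- The best constant in the Gagliardo-Nirenberg inequality
`‖u‖₆⁶ ≤ K ‖u‖₂⁴ ‖u'‖₂²` on `H¹(𝒢)`, i.e. the supremum of the quotients over nonzero `u`. -/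
def bestConstant (G : MetricGraph V E H) : ℝ :=
  sSup {r | ∃ u : G.H1, G.mass u ≠ 0 ∧ r = G.sextic u / (G.mass u ^ 2 * G.kinetic u)}

/-- The critical mass of a noncompact metric graph. -/
def criticalMass (G : MetricGraph V E H) : ℝ :=
  √(3 / G.bestConstant)

end MetricGraph

/-- The real line as a metric graph: two halflines attached at one vertex. -/
def realLine : MetricGraph Unit Empty Bool where
  src := Empty.elim
  tgt := Empty.elim
  len := Empty.elim
  len_pos := fun e => e.elim
  base := fun _ => ()

/-- The critical mass of the real line. -/
def criticalMassReal : ℝ := realLine.criticalMass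

namespace MetricGraph

variable {V E H : Type*}

/-! ### The real line and the towers of bubbles -/

/-- The points with coordinates `t` on the edge `e` and `t'` on the edge `e'` are the same point of
the metric graph: they coincide or are the same vertex. -/
def SamePoint (G : MetricGraph V E H) (e : E ⊕ H) (t : ℝ) (e' : E ⊕ H) (t' : ℝ) : Prop :=
  (e = e' ∧ t = t') ∨ ∃ v, G.IsEnd e t v ∧ G.IsEnd e' t' v

/-- `G` is isometric (as a length space) to the quotient of the real line under the identification
of `x` with `-x` for each `x ∈ S`. The isometry is expressed in coordinates: `σ e` lays the edge
`e` isometrically on the real line, the images of the edges cover the line, and two points of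
edges are the same point of `G` exactly when their images are identified in the quotient.
Vertices of degree two may thus be placed at will on the quotient. -/
def IsFoldedLine (G : MetricGraph V E H) (S : Set ℝ) : Prop :=
  ∃ σ : E ⊕ H → ℝ → ℝ,
    (∀ e, ∀ s ∈ G.interval e, ∀ t ∈ G.interval e, |σ e s - σ e t| = |s - t|) ∧
    (∀ x : ℝ, ∃ e, ∃ t ∈ G.interval e, σ e t = x) ∧
    ∀ e, ∀ t ∈ G.interval e, ∀ e', ∀ t' ∈ G.interval e',
      G.SamePoint e t e' t' ↔
        σ e t = σ e' t' ∨ (σ e t = -σ e' t' ∧ |σ e t| ∈ S)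

/-- `G` is (isometric to) the real line. -/
def IsRealLine (G : MetricGraph V E H) : Prop := G.IsFoldedLine ∅

/-- `G` is (isometric to) a tower of bubbles: the real line with `x_j` identified with `-x_j` for
finitely many, and at least one, numbers `x_j > 0`. -/
def IsTowerOfBubbles (G : MetricGraph V E H) : Prop :=
  ∃ S : Finset ℝ, S.Nonempty ∧ (∀ x ∈ S, 0 < x) ∧ G.IsFoldedLine (S : Set ℝ)

end MetricGraph

end

/-! The heart is a calibration on the line. For `w` in H¹(ℝ), let θ(x) be k = 2/√3 times the mass of
`w` to the right of x; the critical mass of the line then corresponds to a total of π. Since θ' =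
-k|w|² and k²/8 = 1/6, the energy density is half the square |w' + (k/2)|w|² cot θ · w|² minus the
derivative of (k/8)|w|⁴ cot θ (`integral_energyDensity_eq`). So a half-line [a, ∞) with 0 < θ(a) < π
has energy at least (k/8)|w(a)|⁴ cot θ(a) (`le_integral_Ioi`).

Suppose `w` misses the critical mass by m ≥ 0 and w(x) ≠ 0. The scaled masses P, Q on the two sides
of x satisfy P + Q = π - km. Adding the two half-line bounds and using cot P + cot Q ≥ π - P - Q
gives energy at least |w(x)|⁴ m/6, with equality only for m = 0 (`le_integral_energyDensity`).

On the graph, a cycle covering puts every edge on a trail joining two distinct halflines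
(`exists_line`), and a function in H¹(𝒢) restricts to one in H¹(ℝ) along such a trail. Choose one
trail per edge and keep the one on which |u| reaches the largest maximum M; then |u| ≤ M on all of
𝒢. If mass m lies off this trail, the energy there is at least -M⁴m/6, which is exactly what the
trail compensates. Hence the energy is nonnegative at the critical mass, with no rearrangement
(`energy_nonneg`).

If the energy vanishes, there is no mass off the trail, and equality in the calibration turns θ into
a solution of a first-order ODE, so |u|² is a hyperbolic secant along the trail (`exists_sech`). It
never vanishes, so connectedness forces the trail to use every edge. It takes equal values only at
points symmetric about its centre, so only such points can be glued: the graph is the line or a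
tower of bubbles. Conversely the soliton is even and descends to these graphs.

By scaling, nonnegativity at the critical mass is the Gagliardo–Nirenberg inequality with constant
4/π². Solitons escaping along a halfline show that it is sharp, and spreading functions along a
halfline shows that the infimum is at most 0. The line itself satisfies (H), so its critical mass
comes from the same computation. -/

noncomputable section

namespace MetricGraph

variable {V E H : Type*} {G : MetricGraph V E H}

/-! ### Trails and cycles -/

theorem Joins.symm {c : E ⊕ H} {a b : Option V} (h : G.Joins c a b) : G.Joins c b a := by
  cases c <;> simp only [Joins] at h ⊢ <;> tauto

theorem Joins.ends_eq {c : E ⊕ H} {a b a' b' : Option V} (h : G.Joins c a b)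
    (h' : G.Joins c a' b') : (a' = a ∧ b' = b) ∨ (a' = b ∧ b' = a) := by
  cases c <;> simp only [Joins] at h h' <;> grind

/-- `G.Walk a l b`: the list `l` of edges is a walk from `a` to `b`, all the vertices at infinity
being identified. -/
inductive Walk (G : MetricGraph V E H) : Option V → List (E ⊕ H) → Option V → Prop
  | nil (a : Option V) : Walk G a [] a
  | cons {c : E ⊕ H} {a b z : Option V} {l : List (E ⊕ H)} :
      G.Joins c a b → Walk G b l z → Walk G a (c :: l) z

namespace Walk

theorem append {a b z : Option V} {l l' : List (E ⊕ H)} (h : G.Walk a l b) (h' : G.Walk b l' z) :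
    G.Walk a (l ++ l') z := by
  induction h with
  | nil => exact h'
  | cons hj _ ih => exact .cons hj (ih h')

theorem single {c : E ⊕ H} {a b : Option V} (h : G.Joins c a b) : G.Walk a [c] b :=
  .cons h (.nil b)

theorem reverse {a b : Option V} {l : List (E ⊕ H)} (h : G.Walk a l b) :
    G.Walk b l.reverse a := by
  induction h with
  | nil => exact .nil _
  | cons hj _ ih => simpa using ih.append (single hj.symm)

theorem exists_of_append {a z : Option V} {l l' : List (E ⊕ H)} (h : G.Walk a (l ++ l') z) :
    ∃ b, G.Walk a l b ∧ G.Walk b l' z := by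
  induction l generalizing a with
  | nil => exact ⟨a, .nil a, h⟩
  | cons c l ih =>
    cases h with
    | cons hj h =>
      obtain ⟨b, h1, h2⟩ := ih h
      exact ⟨b, .cons hj h1, h2⟩

/-- When an edge is about to be repeated, the stretch between its two uses is cut out. If they have
the same direction, the later one is kept; if opposite, both are dropped, since the walk has come
back to where it started. -/
theorem exists_nodup {a z : Option V} {l : List (E ⊕ H)} (h : G.Walk a l z) :
    ∃ l', G.Walk a l' z ∧ l'.Nodup ∧ l' ⊆ l := by
  induction h with
  | nil a => exact ⟨[], .nil a, List.nodup_nil, by simp⟩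
  | @cons c a b z l hj _ ih =>
    obtain ⟨l', h1, h2, h3⟩ := ih
    by_cases hc : c ∈ l'
    · obtain ⟨s, t, rfl⟩ := List.append_of_mem hc
      obtain ⟨p, -, hp⟩ := h1.exists_of_append
      cases hp with
      | @cons _ _ q _ _ hj' hq =>
        have hsub : t ⊆ l := fun x hx => h3 (by simp [hx])
        have hnd : (c :: t).Nodup := (List.nodup_append.1 h2).2.1
        rcases hj'.ends_eq hj with ⟨rfl, rfl⟩ | ⟨rfl, rfl⟩
        · exact ⟨c :: t, .cons hj' hq, hnd, List.cons_subset_cons c hsub⟩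
        · exact ⟨t, hq, (List.nodup_cons.1 hnd).2, fun x hx => by simp [hsub hx]⟩
    · exact ⟨c :: l', .cons hj h1, List.nodup_cons.2 ⟨hc, h2⟩, List.cons_subset_cons c h3⟩

end Walk

/-- An edge of a cycle can be bypassed. -/
theorem HasCycleCovering.exists_walk (hH : G.HasCycleCovering) {c : E ⊕ H} {a b : Option V}
    (h : G.Joins c a b) : ∃ l, G.Walk b l a ∧ l.Nodup ∧ c ∉ l := by
  obtain ⟨n, v, d, ⟨hn, -, hd, hj⟩, i, rfl⟩ := hH c
  -- Going round the cycle from the far end of the edge: m steps with m < n never meet `d i` again,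
  -- and n - 1 steps end at `v i`. For a self-loop the walk is empty.
  have key : ∀ m : ℕ, m < n → ∃ l, G.Walk (v (i + 1)) l (v (i + 1 + m)) ∧ d i ∉ l := by
    intro m
    induction m with
    | zero => intro _; exact ⟨[], by simpa using Walk.nil _, by simp⟩
    | succ m ih =>
      intro hm
      obtain ⟨l, h1, h2⟩ := ih (by omega)
      refine ⟨l ++ [d (i + 1 + m)], h1.append ?_, ?_⟩
      · have := hj (i + 1 + m)
        have e : i + 1 + (m : ZMod n) + 1 = i + 1 + ((m + 1 : ℕ) : ZMod n) := by push_cast; ring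
        rw [e] at this
        exact Walk.single this
      · simp only [List.mem_append, h2, List.mem_singleton, false_or]
        intro he
        have h0 : ((m + 1 : ℕ) : ZMod n) = 0 := by
          have := hd he
          push_cast
          linear_combination -this
        rw [ZMod.natCast_eq_zero_iff] at h0
        exact absurd (Nat.le_of_dvd (by omega) h0) (by omega)
  obtain ⟨l, h1, h2⟩ := key (n - 1) (by omega)
  have e : i + 1 + ((n - 1 : ℕ) : ZMod n) = i := by
    rw [Nat.cast_sub hn]; simp
  rw [e] at h1
  obtain ⟨l', h3, h4, h5⟩ := h1.exists_nodup
  rcases (hj i).ends_eq h with ⟨rfl, rfl⟩ | ⟨rfl, rfl⟩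
  · exact ⟨l', h3, h4, fun hc => h2 (h5 hc)⟩
  · exact ⟨l'.reverse, h3.reverse, List.nodup_reverse.2 h4,
      fun hc => h2 (h5 (List.mem_reverse.1 hc))⟩

/-- The part of a walk that leads to the first vertex of a closed walk `l`. -/
theorem Walk.exists_hit {y x f : _} {q l : List (E ⊕ H)} (hq : G.Walk y q x) (hl : G.Walk x l x)
    (hf : f ∉ q) :
    ∃ z q' l₁ l₂, G.Walk y q' z ∧ (∀ g ∈ q', g ∉ l ∧ g ≠ f) ∧ l = l₁ ++ l₂ ∧
      G.Walk x l₁ z ∧ G.Walk z l₂ x := by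
  induction hq with
  | nil a => exact ⟨a, [], [], l, .nil a, by simp, rfl, .nil a, hl⟩
  | @cons g a b z q hj hq ih =>
    -- The walk `q` is followed as long as its next edge is not in `l`. When the next edge is in
    -- `l`, the current vertex is one of its ends, and `l` is split just before or just after that
    -- edge according to its orientation.
    by_cases hg : g ∈ l
    · obtain ⟨s, t, rfl⟩ := List.append_of_mem hg
      obtain ⟨p, hp1, hp2⟩ := hl.exists_of_append
      cases hp2 with
      | cons hj' hp3 =>
        rcases hj'.ends_eq hj with ⟨rfl, rfl⟩ | ⟨rfl, rfl⟩
        · exact ⟨_, [], s, g :: t, .nil _, by simp, rfl, hp1, .cons hj' hp3⟩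
        · exact ⟨_, [], s ++ [g], t, .nil _, by simp, by simp, hp1.append (.single hj'), hp3⟩
    · obtain ⟨w, q', l₁, l₂, h1, h2, h3⟩ := ih hl (fun h => hf (List.mem_cons_of_mem _ h))
      refine ⟨w, g :: q', l₁, l₂, .cons hj h1, ?_, h3⟩
      intro k hk
      rcases List.mem_cons.1 hk with rfl | hk
      · exact ⟨hg, fun h => hf (by simp [h])⟩
      · exact h2 k hk

/-- In a bridgeless graph, a closed trail through an edge can be moved to a neighbour. -/
theorem HasCycleCovering.exists_closed_trail_of_joins (hH : G.HasCycleCovering) {c f : E ⊕ H}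
    {x y : Option V} (hf : G.Joins f x y) (h : ∃ l, G.Walk x l x ∧ l.Nodup ∧ c ∈ l) :
    ∃ l, G.Walk y l y ∧ l.Nodup ∧ c ∈ l := by
  obtain ⟨l, hl, hnd, hc⟩ := h
  have rot : ∀ z l₁ l₂, l = l₁ ++ l₂ → G.Walk x l₁ z → G.Walk z l₂ x →
      ∃ l, G.Walk z l z ∧ l.Nodup ∧ c ∈ l := by
    rintro z l₁ l₂ rfl h1 h2
    exact ⟨l₂ ++ l₁, h2.append h1, List.nodup_append_comm.1 hnd,
      by simpa [or_comm] using hc⟩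
  by_cases hfl : f ∈ l
  · obtain ⟨s, t, rfl⟩ := List.append_of_mem hfl
    obtain ⟨p, hp1, hp2⟩ := hl.exists_of_append
    cases hp2 with
    | cons hj' hp3 =>
      rcases hj'.ends_eq hf with ⟨rfl, rfl⟩ | ⟨rfl, rfl⟩
      · exact rot _ (s ++ [f]) t (by simp) (hp1.append (.single hj')) hp3
      · exact rot _ s (f :: t) rfl hp1 (.cons hj' hp3)
  · obtain ⟨q, hq, -, hfq⟩ := hH.exists_walk hf
    obtain ⟨z, q₀, l₁, l₂, h1, h2, rfl, h4, h5⟩ := hq.exists_hit hl hfq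
    obtain ⟨q', h1', hnd', hsub⟩ := h1.exists_nodup
    have h2' : ∀ g ∈ q', g ∉ l₁ ++ l₂ ∧ g ≠ f := fun g hg => h2 g (hsub hg)
    simp only [List.mem_append, not_or] at hc hfl h2'
    rw [List.nodup_append] at hnd
    -- The vertex z splits the closed trail into two arcs between x and z. The new closed trail goes
    -- from y to z off the old one, then to x along whichever arc contains c, and returns to y
    -- through f.
    rcases hc with hc | hc
    · refine ⟨q' ++ (l₁.reverse ++ [f]), h1'.append (h4.reverse.append (.single hf)), ?_,
        by simp [hc]⟩
      rw [List.nodup_append, List.nodup_append]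
      refine ⟨hnd', ⟨List.nodup_reverse.2 hnd.1, by simp, ?_⟩, ?_⟩ <;> simp <;> grind
    · refine ⟨q' ++ (l₂ ++ [f]), h1'.append (h5.append (.single hf)), ?_, by simp [hc]⟩
      rw [List.nodup_append, List.nodup_append]
      refine ⟨hnd', ⟨hnd.2.1, by simp, ?_⟩, ?_⟩ <;> simp <;> grind

/-- A closed trail through c exists at an end of c, because c can be bypassed. It is carried by
connectedness to the base of a halfline, and along that halfline to infinity. -/
theorem HasCycleCovering.exists_closed_trail_none [Nonempty H] (hH : G.HasCycleCovering)
    (hconn : G.Connected) (c : E ⊕ H) : ∃ l, G.Walk none l none ∧ l.Nodup ∧ c ∈ l := by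
  set P : Option V → Prop := fun x => ∃ l, G.Walk x l x ∧ l.Nodup ∧ c ∈ l with hP
  have base : ∃ v, P (some v) := by
    obtain ⟨a, b, hab⟩ : ∃ a b, G.Joins c (some a) b := by
      cases c with
      | inl e => exact ⟨G.src e, some (G.tgt e), .inl ⟨rfl, rfl⟩⟩
      | inr h => exact ⟨G.base h, none, .inl ⟨rfl, rfl⟩⟩
    obtain ⟨l, h1, h2, h3⟩ := hH.exists_walk hab
    exact ⟨a, c :: l, .cons hab h1, List.nodup_cons.2 ⟨h3, h2⟩, by simp⟩
  have step : ∀ v w : V, Relation.EqvGen (fun a b => ∃ e, G.src e = a ∧ G.tgt e = b) v w →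
      (P (some v) ↔ P (some w)) := by
    intro v w h
    induction h with
    | rel a b h =>
      obtain ⟨e, rfl, rfl⟩ := h
      have hj : G.Joins (.inl e) (some (G.src e)) (some (G.tgt e)) := .inl ⟨rfl, rfl⟩
      exact ⟨hH.exists_closed_trail_of_joins hj, hH.exists_closed_trail_of_joins hj.symm⟩
    | refl => rfl
    | symm _ _ _ ih => exact ih.symm
    | trans _ _ _ _ _ ih ih' => exact ih.trans ih'
  obtain ⟨v, hv⟩ := base
  obtain ⟨h⟩ := ‹Nonempty H›
  exact hH.exists_closed_trail_of_joins (f := .inr h) (.inl ⟨rfl, rfl⟩)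
    ((step v (G.base h) (hconn _ _)).1 hv)

/-- `G.Ray a l`: the list `l` is a walk along bounded edges from the vertex `a` that ends with a
halfline. -/
inductive Ray (G : MetricGraph V E H) : V → List (E ⊕ H) → Prop
  | last (h : H) : Ray G (G.base h) [.inr h]
  | cons {e : E} {a b : V} {l : List (E ⊕ H)} :
      G.Joins (.inl e) (some a) (some b) → Ray G b l → Ray G a (.inl e :: l)

/-- Infinity is reached only through a halfline, so the walk is cut at the first one it uses. -/
theorem Walk.exists_ray {a : V} {l : List (E ⊕ H)} (h : G.Walk (some a) l none) :
    ∃ r s, l = r ++ s ∧ G.Ray a r ∧ G.Walk none s none := by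
  induction l generalizing a with
  | nil => cases h
  | cons c l ih =>
    cases h with
    | @cons _ _ b _ _ hj h =>
      cases c with
      | inl e =>
        obtain ⟨b, rfl⟩ : ∃ b', b = some b' := by
          simp only [Joins] at hj; grind
        obtain ⟨r, s, rfl, h1, h2⟩ := ih h
        exact ⟨.inl e :: r, s, rfl, .cons hj h1, h2⟩
      | inr k =>
        simp only [Joins] at hj
        obtain ⟨rfl, rfl⟩ : a = G.base k ∧ b = none := by grind
        exact ⟨[.inr k], l, rfl, .last k, h⟩

/-- Each edge lies on a trail that starts with a halfline, goes along bounded edges and ends with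
another halfline. -/
theorem HasCycleCovering.exists_line [Nonempty H] (hH : G.HasCycleCovering)
    (hconn : G.Connected) (c : E ⊕ H) :
    ∃ (h : H) (r : List (E ⊕ H)), G.Ray (G.base h) r ∧ (.inr h :: r).Nodup ∧ c ∈ .inr h :: r := by
  -- The closed trail at infinity decomposes into excursions, each leaving by a halfline and
  -- returning by another. If c is not in the first excursion, that excursion is dropped and the
  -- rest is shorter.
  have cut : ∀ (n : ℕ) (l : List (E ⊕ H)), l.length = n → G.Walk none l none → l.Nodup → c ∈ l →
      ∃ (h : H) (r : List (E ⊕ H)), G.Ray (G.base h) r ∧ (.inr h :: r).Nodup ∧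
        c ∈ .inr h :: r := by
    intro n
    induction n using Nat.strong_induction_on with
    | _ n ih =>
      intro l hn hl hnd hc
      cases hl with
      | nil => simp at hc
      | @cons d _ b _ l hj hl =>
        cases d with
        | inl e => simp [Joins] at hj
        | inr h =>
          simp only [Joins] at hj
          obtain rfl : b = some (G.base h) := by grind
          obtain ⟨r, s, rfl, h1, h2⟩ := hl.exists_ray
          by_cases hcr : c ∈ .inr h :: r
          · refine ⟨h, r, h1, ?_, hcr⟩
            exact hnd.sublist (List.Sublist.cons_cons _ (List.sublist_append_left r s))
          · refine ih s.length ?_ s rfl h2 ?_ ?_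
            · simp at hn; omega
            · exact hnd.sublist ((List.sublist_append_right r s).cons _)
            · simp only [List.mem_cons, List.mem_append] at hc hcr; tauto
  obtain ⟨l, h1, h2, h3⟩ := hH.exists_closed_trail_none hconn c
  exact cut _ l rfl h1 h2 h3

end MetricGraph

open Filter Topology intervalIntegral

/-! ### Absolutely continuous functions on the line -/

/-- Functions in H¹ are differentiable only almost everywhere, so the calibration needs the
fundamental theorem of calculus in its absolutely continuous form. -/
theorem AbsolutelyContinuousOnInterval.integral_eq_sub_of_ae_hasDerivAt {f f' : ℝ → ℝ} {a b : ℝ}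
    (hf : AbsolutelyContinuousOnInterval f a b)
    (hd : ∀ᵐ x, x ∈ uIcc a b → HasDerivAt f (f' x) x) :
    IntervalIntegrable f' volume a b ∧ ∫ x in a..b, f' x = f b - f a := by
  have hae : ∀ᵐ x, x ∈ uIoc a b → deriv f x = f' x := by
    filter_upwards [hd] with x hx hxm
    exact (hx (uIoc_subset_uIcc hxm)).deriv
  refine ⟨?_, ?_⟩
  · exact hf.intervalIntegrable_deriv.congr_ae ((ae_restrict_iff' measurableSet_uIoc).2 hae)
  · rw [← hf.integral_deriv_eq_sub]
    exact (integral_congr_ae hae).symm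

/-- `w` is an element of `H¹(ℝ)`, in its continuous representative, with weak derivative `w'`. -/
structure IsH1Line (w w' : ℝ → ℂ) : Prop where
  intervalIntegrable : ∀ a b, IntervalIntegrable w' volume a b
  sub_eq : ∀ a b, w b - w a = ∫ x in a..b, w' x
  integrable_sq : Integrable fun x => ‖w x‖ ^ 2
  integrable_deriv_sq : Integrable fun x => ‖w' x‖ ^ 2

namespace IsH1Line

variable {w w' : ℝ → ℂ}

theorem eq_add (h : IsH1Line w w') (a : ℝ) : w = fun x => w a + ∫ t in a..x, w' t := by
  ext x
  rw [← h.sub_eq a x]; ring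

theorem continuous (h : IsH1Line w w') : Continuous w := by
  rw [h.eq_add 0]
  exact continuous_const.add (continuous_primitive h.intervalIntegrable 0)

theorem locallyIntegrable (h : IsH1Line w w') : LocallyIntegrable w' := by
  intro x
  refine ⟨Icc (x - 1) (x + 1), Icc_mem_nhds (by linarith) (by linarith), ?_⟩
  exact (intervalIntegrable_iff_integrableOn_Icc_of_le (by linarith)).1
    (h.intervalIntegrable (x - 1) (x + 1))

theorem ae_hasDerivAt (h : IsH1Line w w') : ∀ᵐ x, HasDerivAt w (w' x) x := by
  filter_upwards [LocallyIntegrable.ae_hasDerivAt_integral h.locallyIntegrable] with x hx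
  rw [h.eq_add 0]
  exact (hx 0).const_add _

theorem ae_hasDerivAt_sq (h : IsH1Line w w') :
    ∀ᵐ x, HasDerivAt (fun x => ‖w x‖ ^ 2) (2 * inner ℝ (w x) (w' x)) x := by
  filter_upwards [h.ae_hasDerivAt] with x hx using hx.norm_sq

/-- The real and imaginary parts are primitives of integrable functions, and |w|² is the sum of
their squares. -/
theorem absolutelyContinuous_sq (h : IsH1Line w w') (a b : ℝ) :
    AbsolutelyContinuousOnInterval (fun x => ‖w x‖ ^ 2) a b := by
  have key : ∀ L : ℂ →L[ℝ] ℝ, AbsolutelyContinuousOnInterval (fun x => L (w x)) a b := by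
    intro L
    have hi : IntervalIntegrable (fun x => L (w' x)) volume a b :=
      ⟨L.integrable_comp (h.intervalIntegrable a b).1, L.integrable_comp (h.intervalIntegrable a b).2⟩
    have h2 := hi.absolutelyContinuousOnInterval_intervalIntegral (c := a) (by simp)
    have hc : AbsolutelyContinuousOnInterval (fun _ : ℝ => L (w a)) a b :=
      ContDiffOn.absolutelyContinuousOnInterval contDiffOn_const
    have e : (fun x => L (w x)) = fun x => L (w a) + ∫ t in a..x, L (w' t) := by
      ext x
      rw [L.intervalIntegral_comp_comm (h.intervalIntegrable a x), ← map_add, ← h.sub_eq a x]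
      simp
    rw [e]
    exact hc.fun_add h2
  have hr := key Complex.reCLM
  have hi := key Complex.imCLM
  have := (hr.mul hr).add (hi.mul hi)
  convert! this using 1
  ext x
  simp [Complex.sq_norm, Complex.normSq_apply]

theorem integrable_inner (h : IsH1Line w w') : Integrable fun x => 2 * inner ℝ (w x) (w' x) := by
  refine (h.integrable_sq.add h.integrable_deriv_sq).mono' ?_ ?_
  · exact (h.continuous.aestronglyMeasurable.inner h.locallyIntegrable.aestronglyMeasurable).const_mul _
  · filter_upwards with x
    have h1 := abs_real_inner_le_norm (w x) (w' x)
    simp only [Real.norm_eq_abs, abs_mul, abs_two, Pi.add_apply]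
    nlinarith [sq_nonneg (‖w x‖ - ‖w' x‖)]

theorem sq_sub_sq (h : IsH1Line w w') (a b : ℝ) :
    ‖w b‖ ^ 2 - ‖w a‖ ^ 2 = ∫ x in a..b, 2 * inner ℝ (w x) (w' x) := by
  refine ((h.absolutelyContinuous_sq a b).integral_eq_sub_of_ae_hasDerivAt ?_).2.symm
  filter_upwards [h.ae_hasDerivAt_sq] with x hx _ using hx

/-- The derivative of |w|² is integrable, so a limit exists; a positive limit would contradict the
integrability of |w|². -/
theorem tendsto_sq_atTop (h : IsH1Line w w') : Tendsto (fun x => ‖w x‖ ^ 2) atTop (𝓝 0) := by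
  have h1 := intervalIntegral_tendsto_integral_Ioi 0 h.integrable_inner.integrableOn tendsto_id
  set L := ∫ x in Ioi 0, 2 * inner ℝ (w x) (w' x)
  have h2 : Tendsto (fun x => ‖w x‖ ^ 2) atTop (𝓝 (‖w 0‖ ^ 2 + L)) := by
    refine (h1.const_add (‖w 0‖ ^ 2)).congr fun x => ?_
    rw [id, ← h.sq_sub_sq 0 x]; ring
  by_cases h0 : ‖w 0‖ ^ 2 + L = 0
  · rwa [h0] at h2
  · exfalso
    have hpos : 0 < ‖w 0‖ ^ 2 + L :=
      lt_of_le_of_ne (ge_of_tendsto' h2 fun x => by positivity) (Ne.symm h0)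
    obtain ⟨b, hb⟩ := (h2.eventually (lt_mem_nhds (half_lt_self hpos))).exists_forall_of_atTop
    have hint : IntegrableOn (fun _ : ℝ => (‖w 0‖ ^ 2 + L) / 2) (Ioi b) := by
      refine (h.integrable_sq.integrableOn (s := Ioi b)).mono' (by fun_prop) ?_
      filter_upwards [ae_restrict_mem measurableSet_Ioi] with x hx
      rw [Real.norm_of_nonneg (by positivity)]
      exact (hb x (le_of_lt hx)).le
    rw [integrableOn_const_iff] at hint
    simp only [Real.volume_Ioi, lt_self_iff_false, or_false] at hint
    exact h0 (by simpa using hint)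

/-- Reflection transfers every estimate on right half-lines to left half-lines. -/
theorem neg_arg (h : IsH1Line w w') : IsH1Line (fun x => w (-x)) (fun x => -w' (-x)) where
  intervalIntegrable a b := by
    have := (h.intervalIntegrable (-a) (-b)).comp_mul_left (c := -1)
    simpa using! this.neg
  sub_eq a b := by
    rw [intervalIntegral.integral_neg, integral_comp_neg, h.sub_eq, integral_symm]
  integrable_sq := h.integrable_sq.comp_neg
  integrable_deriv_sq := by simpa using h.integrable_deriv_sq.comp_neg

theorem exists_bound (h : IsH1Line w w') : ∃ C, ∀ x, ‖w x‖ ^ 2 ≤ C := by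
  refine ⟨‖w 0‖ ^ 2 + ∫ x, ‖2 * inner ℝ (w x) (w' x)‖, fun x => ?_⟩
  have h1 := h.sq_sub_sq 0 x
  have h2 : ‖∫ x in (0 : ℝ)..x, 2 * inner ℝ (w x) (w' x)‖ ≤
      ∫ x, ‖2 * inner ℝ (w x) (w' x)‖ := by
    refine norm_integral_le_integral_norm_uIoc.trans ?_
    exact setIntegral_le_integral h.integrable_inner.norm (by filter_upwards with x; positivity)
  have h3 := le_abs_self (∫ x in (0 : ℝ)..x, 2 * inner ℝ (w x) (w' x))
  rw [← Real.norm_eq_abs] at h3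
  linarith

theorem integrable_six (h : IsH1Line w w') : Integrable fun x => ‖w x‖ ^ 6 := by
  obtain ⟨C, hC⟩ := h.exists_bound
  refine (h.integrable_sq.const_mul (C ^ 2)).mono' (by have := h.continuous; fun_prop) ?_
  filter_upwards with x
  rw [Real.norm_of_nonneg (by positivity)]
  have : (‖w x‖ ^ 2) ^ 2 ≤ C ^ 2 := pow_le_pow_left₀ (by positivity) (hC x) 2
  nlinarith [sq_nonneg ‖w x‖]

end IsH1Line

/-- The energy density of a function on the line. -/
def energyDensity (w w' : ℝ → ℂ) (x : ℝ) : ℝ := 1 / 2 * ‖w' x‖ ^ 2 - 1 / 6 * ‖w x‖ ^ 6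

/-- The mass of `w` to the right of `x`. -/
def tailMass (w : ℝ → ℂ) (x : ℝ) : ℝ := ∫ t in Ioi x, ‖w t‖ ^ 2

/-- The scale `2 / √3`, at which the critical mass of the line becomes `π`. -/
def massScale : ℝ := 2 / √3

theorem massScale_pos : 0 < massScale := by unfold massScale; positivity

theorem massScale_sq : massScale ^ 2 = 4 / 3 := by
  unfold massScale
  rw [div_pow, Real.sq_sqrt (by norm_num)]; norm_num

/-! ### Mass on the right of a point and the calibration -/

namespace IsH1Line

variable {w w' : ℝ → ℂ}

theorem integrable_energyDensity (h : IsH1Line w w') : Integrable (energyDensity w w') :=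
  (h.integrable_deriv_sq.const_mul _).sub (h.integrable_six.const_mul _)

theorem tailMass_nonneg (w : ℝ → ℂ) (x : ℝ) : 0 ≤ tailMass w x :=
  integral_nonneg fun _ => by positivity

theorem tailMass_sub (h : IsH1Line w w') (a b : ℝ) :
    tailMass w a - tailMass w b = ∫ x in a..b, ‖w x‖ ^ 2 := by
  unfold tailMass
  have := integral_interval_add_Ioi' (h.integrable_sq.intervalIntegrable (a := a) (b := b))
    (h.integrable_sq.integrableOn (s := Ioi b))
  linarith

theorem hasDerivAt_tailMass (h : IsH1Line w w') (x : ℝ) :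
    HasDerivAt (tailMass w) (-‖w x‖ ^ 2) x := by
  have e : tailMass w = fun y => tailMass w 0 - ∫ x in (0 : ℝ)..y, ‖w x‖ ^ 2 := by
    ext y; rw [← h.tailMass_sub 0 y]; ring
  rw [e]
  have hc : Continuous fun x => ‖w x‖ ^ 2 := by have := h.continuous; fun_prop
  exact (hc.integral_hasStrictDerivAt 0 x).hasDerivAt.const_sub _

theorem tailMass_antitone (h : IsH1Line w w') : Antitone (tailMass w) :=
  antitone_of_hasDerivAt_nonpos h.hasDerivAt_tailMass fun x => by simp

theorem tendsto_tailMass (h : IsH1Line w w') : Tendsto (tailMass w) atTop (𝓝 0) := by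
  have h1 := (intervalIntegral_tendsto_integral_Ioi 0 h.integrable_sq.integrableOn tendsto_id).const_sub
    (tailMass w 0)
  refine (h1.congr fun x => ?_).trans (by simp [tailMass])
  rw [id, ← h.tailMass_sub 0 x]; ring

/-- The calibration identity: `½|w'|² - ⅙|w|⁶` differs by a total derivative from a square. -/
theorem integral_energyDensity_eq (h : IsH1Line w w') {θ : ℝ → ℝ}
    (hθ : ∀ x, HasDerivAt θ (-(massScale * ‖w x‖ ^ 2)) x) {a b : ℝ}
    (hs : ∀ x ∈ uIcc a b, Real.sin (θ x) ≠ 0) :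
    IntervalIntegrable (fun x => ‖w' x + (massScale / 2 * ‖w x‖ ^ 2 *
        (Real.cos (θ x) / Real.sin (θ x))) • w x‖ ^ 2) volume a b ∧
    ∫ x in a..b, energyDensity w w' x =
      1 / 2 * (∫ x in a..b, ‖w' x + (massScale / 2 * ‖w x‖ ^ 2 *
        (Real.cos (θ x) / Real.sin (θ x))) • w x‖ ^ 2) +
      massScale / 8 * ‖w a‖ ^ 4 * (Real.cos (θ a) / Real.sin (θ a)) -
      massScale / 8 * ‖w b‖ ^ 4 * (Real.cos (θ b) / Real.sin (θ b)) := by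
  have hθc : ContDiff ℝ 1 θ := by
    rw [contDiff_one_iff_deriv]
    refine ⟨fun x => (hθ x).differentiableAt, ?_⟩
    rw [funext fun x => (hθ x).deriv]
    have := h.continuous
    fun_prop
  have hc : AbsolutelyContinuousOnInterval (fun x => Real.cos (θ x) / Real.sin (θ x)) a b :=
    ((Real.contDiff_cos.comp hθc).contDiffOn.div (Real.contDiff_sin.comp hθc).contDiffOn
      hs).absolutelyContinuousOnInterval
  have hq := h.absolutelyContinuous_sq a b
  have hF := ((hq.fun_mul hq).fun_mul hc).const_mul (massScale / 8)
  set ψ : ℝ → ℝ := fun x => ‖w' x + (massScale / 2 * ‖w x‖ ^ 2 *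
        (Real.cos (θ x) / Real.sin (θ x))) • w x‖ ^ 2 with hψ
  -- Differentiating cot θ gives k|w|²/sin²θ = k|w|²(1 + cot²θ). With k² = 4/3, the 1 yields the
  -- term |w|⁶/6 and the cot²θ completes the square.
  have hd : ∀ᵐ x, x ∈ uIcc a b → HasDerivAt (fun x => massScale / 8 *
      (‖w x‖ ^ 2 * ‖w x‖ ^ 2 * (Real.cos (θ x) / Real.sin (θ x))))
      (1 / 2 * ψ x - energyDensity w w' x) x := by
    filter_upwards [h.ae_hasDerivAt_sq] with x hx hxm
    have h1 := hs x hxm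
    have h2 := ((hx.mul hx).mul ((hθ x).cos.div (hθ x).sin h1)).const_mul (massScale / 8)
    refine h2.congr_deriv ?_
    simp only [hψ, energyDensity]
    rw [@norm_add_sq_real, inner_smul_right, norm_smul, real_inner_comm, mul_pow, Real.norm_eq_abs,
      sq_abs]
    have h3 := Real.sin_sq_add_cos_sq (θ x)
    have h4 := massScale_sq
    simp only [Pi.mul_apply, Pi.div_apply]
    field_simp
    generalize Real.sin (θ x) = s at *
    generalize Real.cos (θ x) = c at *
    generalize massScale = k at *
    generalize ‖w x‖ = r at *
    have h5 : s ^ 2 = 1 - c ^ 2 := by linarith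
    have h6 : c ^ 2 = 1 - s ^ 2 := by linarith
    ring_nf
    simp only [h4, h6]
    ring
  obtain ⟨h1, h2⟩ := hF.integral_eq_sub_of_ae_hasDerivAt hd
  have h3 : IntervalIntegrable (energyDensity w w') volume a b :=
    h.integrable_energyDensity.intervalIntegrable
  have h4 : IntervalIntegrable ψ volume a b := by
    refine ((h1.add h3).const_mul 2).congr fun x _ => ?_
    simp
  refine ⟨h4, ?_⟩
  rw [integral_sub (h4.const_mul _) h3, intervalIntegral.integral_const_mul] at h2
  linear_combination -h2

end IsH1Line

/-! ### Sharp energy bounds and rigidity on the line -/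

namespace IsH1Line

variable {w w' : ℝ → ℂ}

theorem hasDerivAt_massScale_tailMass (h : IsH1Line w w') (ε x : ℝ) :
    HasDerivAt (fun x => massScale * tailMass w x + ε) (-(massScale * ‖w x‖ ^ 2)) x :=
  (((h.hasDerivAt_tailMass x).const_mul massScale).add_const ε).congr_deriv (by ring)

theorem tendsto_pow_four (h : IsH1Line w w') : Tendsto (fun x => ‖w x‖ ^ 4) atTop (𝓝 0) := by
  have := h.tendsto_sq_atTop.pow 2
  simpa [← pow_mul] using this

/-- Sharp lower bound for the energy on a half-line, in terms of the mass and the initial value. -/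
theorem le_integral_Ioi (h : IsH1Line w w') {a : ℝ} (h0 : 0 < tailMass w a)
    (hπ : massScale * tailMass w a < Real.pi) :
    massScale / 8 * ‖w a‖ ^ 4 *
      (Real.cos (massScale * tailMass w a) / Real.sin (massScale * tailMass w a)) ≤
      ∫ x in Ioi a, energyDensity w w' x := by
  have hk := massScale_pos
  set θ := massScale * tailMass w a with hθ
  have hθ0 : 0 < θ := by positivity
  -- The tail mass tends to 0, where the cotangent is singular. Shifting the angle by ε keeps the
  -- sine away from 0, so the boundary term at infinity vanishes together with |w|⁴; afterwards ε
  -- tends to 0.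
  have key : ∀ ε ∈ Ioo 0 (Real.pi - θ), massScale / 8 * ‖w a‖ ^ 4 *
      (Real.cos (θ + ε) / Real.sin (θ + ε)) ≤ ∫ x in Ioi a, energyDensity w w' x := by
    intro ε hε
    have hpos : ∀ x ≥ a, 0 < Real.sin (massScale * tailMass w x + ε) := by
      intro x hx
      have h1 := h.tailMass_antitone hx
      have h2 := tailMass_nonneg w x
      refine Real.sin_pos_of_pos_of_lt_pi ?_ ?_
      · have := hε.1; positivity
      · have := hε.2
        nlinarith
    have h1 := intervalIntegral_tendsto_integral_Ioi a h.integrable_energyDensity.integrableOn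
      tendsto_id
    have h2 : Tendsto (fun x => massScale / 8 * ‖w a‖ ^ 4 * (Real.cos (θ + ε) / Real.sin (θ + ε)) -
        massScale / 8 * ‖w x‖ ^ 4 * (Real.cos (massScale * tailMass w x + ε) /
          Real.sin (massScale * tailMass w x + ε))) atTop
        (𝓝 (massScale / 8 * ‖w a‖ ^ 4 * (Real.cos (θ + ε) / Real.sin (θ + ε)) -
          massScale / 8 * 0 * (Real.cos (massScale * 0 + ε) / Real.sin (massScale * 0 + ε)))) := by
      have h3 : Tendsto (fun x => massScale * tailMass w x + ε) atTop (𝓝 (massScale * 0 + ε)) :=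
        (h.tendsto_tailMass.const_mul _).add_const _
      refine tendsto_const_nhds.sub ((h.tendsto_pow_four.const_mul _).mul ?_)
      refine ((Real.continuous_cos.tendsto _).comp h3).div ((Real.continuous_sin.tendsto _).comp h3) ?_
      have := hε.2
      refine (Real.sin_pos_of_pos_of_lt_pi ?_ ?_).ne' <;> linarith [hε.1]
    rw [show massScale / 8 * ‖w a‖ ^ 4 * (Real.cos (θ + ε) / Real.sin (θ + ε)) -
      massScale / 8 * 0 * (Real.cos (massScale * 0 + ε) / Real.sin (massScale * 0 + ε)) =
      massScale / 8 * ‖w a‖ ^ 4 * (Real.cos (θ + ε) / Real.sin (θ + ε)) by ring] at h2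
    refine le_of_tendsto_of_tendsto h2 h1 ?_
    filter_upwards [eventually_ge_atTop a] with b hb
    obtain ⟨-, hid⟩ := h.integral_energyDensity_eq (h.hasDerivAt_massScale_tailMass ε)
      (a := a) (b := b) fun x hx => (hpos x (by rw [uIcc_of_le hb] at hx; exact hx.1)).ne'
    rw [id, hid]
    have : 0 ≤ ∫ x in a..b, ‖w' x + (massScale / 2 * ‖w x‖ ^ 2 *
        (Real.cos (massScale * tailMass w x + ε) / Real.sin (massScale * tailMass w x + ε))) • w x‖ ^ 2 :=
      intervalIntegral.integral_nonneg hb fun _ _ => by positivity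
    linarith
  have hlim : Tendsto (fun ε => massScale / 8 * ‖w a‖ ^ 4 *
      (Real.cos (θ + ε) / Real.sin (θ + ε))) (𝓝[>] 0) (𝓝 (massScale / 8 * ‖w a‖ ^ 4 *
      (Real.cos θ / Real.sin θ))) := by
    have hc : ContinuousAt (fun ε => massScale / 8 * ‖w a‖ ^ 4 *
      (Real.cos (θ + ε) / Real.sin (θ + ε))) 0 := by
      refine continuousAt_const.mul (ContinuousAt.div (by fun_prop) (by fun_prop) ?_)
      simpa using (Real.sin_pos_of_pos_of_lt_pi hθ0 hπ).ne'
    simpa using hc.tendsto.mono_left (nhdsWithin_le_nhds (s := Ioi 0))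
  refine le_of_tendsto hlim ?_
  filter_upwards [Ioo_mem_nhdsGT (show (0 : ℝ) < Real.pi - θ by linarith)] with ε hε using key ε hε

/-- In the equality case of the half-line bound, `|w|²` is proportional to the sine of the scaled
mass on the right. -/
theorem sq_eq_of_integral_Ioi_le (h : IsH1Line w w') {a : ℝ}
    (hπ : massScale * tailMass w a < Real.pi)
    (hle : ∫ x in Ioi a, energyDensity w w' x ≤ massScale / 8 * ‖w a‖ ^ 4 *
      (Real.cos (massScale * tailMass w a) / Real.sin (massScale * tailMass w a))) {b : ℝ}
    (hab : a ≤ b) :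
    ‖w b‖ ^ 2 = ‖w a‖ ^ 2 / Real.sin (massScale * tailMass w a) *
      Real.sin (massScale * tailMass w b) := by
  have hk := massScale_pos
  -- If there is no mass beyond b, the tail mass is constant there, and its derivative -|w(b)|²
  -- vanishes like the sine on the right-hand side.
  rcases (tailMass_nonneg w b).eq_or_lt with hb | hb
  · rw [← hb]
    simp only [mul_zero, Real.sin_zero]
    have h1 : ∀ᶠ x in 𝓝[>] b, tailMass w x = tailMass w b := by
      filter_upwards [self_mem_nhdsWithin] with x hx
      have h1 := h.tailMass_antitone (le_of_lt hx)
      have h2 := tailMass_nonneg w x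
      linarith
    have h2 : HasDerivWithinAt (tailMass w) 0 (Ioi b) b :=
      (hasDerivWithinAt_const b (Ioi b) (tailMass w b)).congr_of_eventuallyEq h1 rfl
    have h3 := (uniqueDiffWithinAt_Ioi b).eq_deriv _ h2 (h.hasDerivAt_tailMass b).hasDerivWithinAt
    linarith
  · have hsin : ∀ x ∈ uIcc a b, 0 < Real.sin (massScale * tailMass w x + 0) := by
      intro x hx
      rw [uIcc_of_le hab] at hx
      have h1 := h.tailMass_antitone hx.1
      have h2 := h.tailMass_antitone hx.2
      refine Real.sin_pos_of_pos_of_lt_pi ?_ ?_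
      · have : 0 < tailMass w x := by linarith
        positivity
      · nlinarith
    obtain ⟨hi, hid⟩ := h.integral_energyDensity_eq (h.hasDerivAt_massScale_tailMass 0)
      (a := a) (b := b) fun x hx => (hsin x hx).ne'
    have htail := h.le_integral_Ioi hb (by
      have := h.tailMass_antitone hab
      nlinarith)
    have hsplit := integral_interval_add_Ioi' (h.integrable_energyDensity.intervalIntegrable
      (a := a) (b := b)) (h.integrable_energyDensity.integrableOn (s := Ioi b))
    simp only [add_zero] at hid hi hsin
    set ψ : ℝ → ℝ := fun x => ‖w' x + (massScale / 2 * ‖w x‖ ^ 2 *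
        (Real.cos (massScale * tailMass w x) / Real.sin (massScale * tailMass w x))) • w x‖ ^ 2
      with hψ
    -- The bound on [b, ∞) and the assumed equality on [a, ∞) leave no room for the square on [a,
    -- b]. Thus w' = -(k/2)|w|² cot θ · w almost everywhere, which makes |w|²/sin θ constant.
    have hψ0 : ∫ x in a..b, ψ x = 0 := by
      refine le_antisymm (by linarith) ?_
      exact intervalIntegral.integral_nonneg hab fun _ _ => by positivity
    rw [integral_eq_zero_iff_of_le_of_nonneg_ae hab
      (by filter_upwards with x; simp only [hψ, Pi.zero_apply]; positivity) hi] at hψ0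
    have hψ1 : ∀ᵐ x, x ∈ Ioc a b → ψ x = 0 := (ae_restrict_iff' measurableSet_Ioc).1 hψ0
    have hs : AbsolutelyContinuousOnInterval
        (fun x => (Real.sin (massScale * tailMass w x))⁻¹) a b := by
      have hc : ContDiff ℝ 1 (tailMass w) := by
        rw [contDiff_one_iff_deriv]
        refine ⟨fun x => (h.hasDerivAt_tailMass x).differentiableAt, ?_⟩
        rw [funext fun x => (h.hasDerivAt_tailMass x).deriv]
        have := h.continuous
        fun_prop
      exact ((Real.contDiff_sin.comp (contDiff_const.mul hc)).contDiffOn.inv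
        fun x hx => (hsin x hx).ne').absolutelyContinuousOnInterval
    have hd : ∀ᵐ x, x ∈ uIcc a b → HasDerivAt (fun x => ‖w x‖ ^ 2 *
        (Real.sin (massScale * tailMass w x))⁻¹) 0 x := by
      have hne : ∀ᵐ x : ℝ, x ≠ a := by simp [ae_iff, measure_singleton]
      filter_upwards [h.ae_hasDerivAt_sq, hψ1, hne] with x hx hx1 hxa hxm
      have hs0 := hsin x hxm
      have hx2 := hx1 (by
        rw [uIcc_of_le hab] at hxm
        exact ⟨lt_of_le_of_ne hxm.1 (Ne.symm hxa), hxm.2⟩)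
      simp only [hψ, ne_eq, OfNat.ofNat_ne_zero, not_false_eq_true, pow_eq_zero_iff,
        norm_eq_zero] at hx2
      have hw' := eq_neg_of_add_eq_zero_left hx2
      rw [hw', inner_neg_right, inner_smul_right, real_inner_self_eq_norm_sq] at hx
      refine (hx.mul (((h.hasDerivAt_tailMass x).const_mul massScale).sin.inv hs0.ne')).congr_deriv ?_
      simp only [Pi.inv_apply]
      field_simp
      ring
    have h3 := ((h.absolutelyContinuous_sq a b).fun_mul hs).integral_eq_sub_of_ae_hasDerivAt hd
    have h4 := h3.2
    simp only [intervalIntegral.integral_zero] at h4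
    have h5 := hsin b (by simp)
    have h6 := hsin a (by simp)
    field_simp at h4 ⊢
    linarith

theorem tailMass_neg_arg (h : IsH1Line w w') (x : ℝ) :
    tailMass (fun y => w (-y)) (-x) = (∫ y, ‖w y‖ ^ 2) - tailMass w x := by
  have h1 := integral_Iic_add_Ioi (h.integrable_sq.integrableOn (s := Iic x))
    (h.integrable_sq.integrableOn (s := Ioi x))
  have h2 := integral_comp_neg_Ioi (-x) fun y => ‖w y‖ ^ 2
  rw [neg_neg] at h2
  unfold tailMass
  linarith

theorem integral_energyDensity_neg_arg (h : IsH1Line w w') (x : ℝ) :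
    (∫ y in Ioi (-x), energyDensity (fun y => w (-y)) (fun y => -w' (-y)) y) =
      (∫ y, energyDensity w w' y) - ∫ y in Ioi x, energyDensity w w' y := by
  have h1 := integral_Iic_add_Ioi (h.integrable_energyDensity.integrableOn (s := Iic x))
    (h.integrable_energyDensity.integrableOn (s := Ioi x))
  have h2 := integral_comp_neg_Ioi (-x) fun y => energyDensity w w' y
  rw [neg_neg] at h2
  have h3 : (fun y => energyDensity w w' (-y)) =
      energyDensity (fun y => w (-y)) (fun y => -w' (-y)) := by
    ext y; simp [energyDensity]
  rw [h3] at h2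
  linarith

theorem tailMass_pos (h : IsH1Line w w') {x : ℝ} (hx : 0 < ‖w x‖ ^ 2) : 0 < tailMass w x := by
  refine lt_of_le_of_ne (tailMass_nonneg w x) fun h0 => ?_
  have h1 : ∀ᶠ y in 𝓝[>] x, tailMass w y = tailMass w x := by
    filter_upwards [self_mem_nhdsWithin] with y hy
    have h1 := h.tailMass_antitone (le_of_lt hy)
    have h2 := tailMass_nonneg w y
    linarith
  have h2 : HasDerivWithinAt (tailMass w) 0 (Ioi x) x :=
    (hasDerivWithinAt_const x (Ioi x) (tailMass w x)).congr_of_eventuallyEq h1 rfl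
  have h3 := (uniqueDiffWithinAt_Ioi x).eq_deriv _ h2 (h.hasDerivAt_tailMass x).hasDerivWithinAt
  linarith

end IsH1Line

/-- `cot P + cot Q` dominates the defect `π - P - Q`. -/
theorem defect_le_cot_add_cot {P Q : ℝ} (hP : 0 < P) (hQ : 0 < Q) (hPQ : P + Q < Real.pi) :
    Real.pi - P - Q < Real.cos P / Real.sin P + Real.cos Q / Real.sin Q := by
  have hsP := Real.sin_pos_of_pos_of_lt_pi hP (by linarith)
  have hsQ := Real.sin_pos_of_pos_of_lt_pi hQ (by linarith)
  -- With d half the defect, cot P + cot Q = sin 2d/(sin P sin Q). Since sin P sin Q ≤ cos²d, this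
  -- is at least 2 tan d, which exceeds 2d.
  obtain ⟨d, hd⟩ : ∃ d, d = (Real.pi - P - Q) / 2 := ⟨_, rfl⟩
  have hd0 : 0 < d := by linarith
  have hd1 : d < Real.pi / 2 := by linarith
  have hc := Real.cos_pos_of_mem_Ioo ⟨by linarith, hd1⟩
  have hs := Real.sin_pos_of_pos_of_lt_pi hd0 (by linarith)
  have h1 := Real.lt_tan hd0 hd1
  rw [Real.tan_eq_sin_div_cos, lt_div_iff₀ hc] at h1
  have hsum : Real.sin (P + Q) = 2 * Real.sin d * Real.cos d := by
    rw [← Real.sin_two_mul, ← Real.sin_pi_sub]; congr 1; linarith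
  have hcos : Real.cos (P + Q) = 1 - 2 * Real.cos d ^ 2 := by
    have : P + Q = Real.pi - 2 * d := by linarith
    rw [this, Real.cos_pi_sub, Real.cos_two_mul]; ring
  have hprod : Real.sin P * Real.sin Q ≤ Real.cos d ^ 2 := by
    have h2 := Real.cos_add P Q
    have h3 := Real.cos_sub P Q
    have h4 := Real.cos_le_one (P - Q)
    nlinarith
  have e : Real.cos P / Real.sin P + Real.cos Q / Real.sin Q =
      Real.sin (P + Q) / (Real.sin P * Real.sin Q) := by
    rw [Real.sin_add]; field_simp; ring
  rw [e, lt_div_iff₀ (by positivity), hsum]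
  have : Real.pi - P - Q = 2 * d := by linarith
  rw [this]
  calc 2 * d * (Real.sin P * Real.sin Q) ≤ 2 * d * Real.cos d ^ 2 := by gcongr
    _ < 2 * Real.sin d * Real.cos d := by nlinarith

namespace IsH1Line

variable {w w' : ℝ → ℂ}

theorem scaled_masses (h : IsH1Line w w') {x : ℝ} (hx : 0 < ‖w x‖ ^ 2) {m : ℝ} (hm : 0 ≤ m)
    (htot : massScale * ((∫ y, ‖w y‖ ^ 2) + m) = Real.pi) :
    0 < tailMass w x ∧ 0 < tailMass (fun y => w (-y)) (-x) ∧
      massScale * tailMass w x < Real.pi ∧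
      massScale * tailMass (fun y => w (-y)) (-x) < Real.pi ∧
      massScale * tailMass w x + massScale * tailMass (fun y => w (-y)) (-x) =
        Real.pi - massScale * m := by
  have hk := massScale_pos
  have h1 := h.tailMass_pos hx
  have h2 : 0 < tailMass (fun y => w (-y)) (-x) := h.neg_arg.tailMass_pos (by simpa using hx)
  have h3 := h.tailMass_neg_arg x
  have h4 : massScale * tailMass w x + massScale * tailMass (fun y => w (-y)) (-x) =
      Real.pi - massScale * m := by rw [h3]; linarith
  have h5 : 0 ≤ massScale * m := by positivity
  have h6 : 0 < massScale * tailMass w x := by positivity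
  have h7 : 0 < massScale * tailMass (fun y => w (-y)) (-x) := by positivity
  exact ⟨h1, h2, by linarith, by linarith, h4⟩

/-- If the mass of `w` is `m` less than the critical mass, the energy of `w` is at least that of a
plateau of mass `m`, with opposite sign. -/
theorem le_integral_energyDensity (h : IsH1Line w w') {x : ℝ} (hx : 0 < ‖w x‖ ^ 2) {m : ℝ}
    (hm : 0 ≤ m) (htot : massScale * ((∫ y, ‖w y‖ ^ 2) + m) = Real.pi) :
    ‖w x‖ ^ 4 * m / 6 ≤ ∫ y, energyDensity w w' y ∧
      ((∫ y, energyDensity w w' y) ≤ ‖w x‖ ^ 4 * m / 6 → m = 0 ∧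
        (∫ y in Ioi x, energyDensity w w' y) ≤ massScale / 8 * ‖w x‖ ^ 4 *
          (Real.cos (massScale * tailMass w x) / Real.sin (massScale * tailMass w x)) ∧
        (∫ y in Ioi (-x), energyDensity (fun y => w (-y)) (fun y => -w' (-y)) y) ≤
          massScale / 8 * ‖w x‖ ^ 4 *
          (Real.cos (massScale * tailMass (fun y => w (-y)) (-x)) /
            Real.sin (massScale * tailMass (fun y => w (-y)) (-x)))) := by
  have hk := massScale_pos
  have hk2 := massScale_sq
  obtain ⟨h1, h2, h3, h4, h5⟩ := h.scaled_masses hx hm htot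
  have hr := h.le_integral_Ioi h1 h3
  have hl := h.neg_arg.le_integral_Ioi h2 h4
  simp only [neg_neg] at hl
  have hsum := h.integral_energyDensity_neg_arg x
  set P := massScale * tailMass w x with hP
  set Q := massScale * tailMass (fun y => w (-y)) (-x) with hQ
  have hM : 0 < ‖w x‖ ^ 4 := by
    have : ‖w x‖ ^ 4 = (‖w x‖ ^ 2) ^ 2 := by ring
    rw [this]; positivity
  -- Here k²/8 = 1/6 again: the defect km, weighted by (k/8)|w|⁴, has exactly the size of the sextic
  -- energy of a plateau of mass m.
  have e : ‖w x‖ ^ 4 * m / 6 = massScale / 8 * ‖w x‖ ^ 4 * (massScale * m) := by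
    linear_combination (-(‖w x‖ ^ 4 * m / 8)) * hk2
  have hP0 : 0 < P := by positivity
  have hQ0 : 0 < Q := by positivity
  have hc : 0 < massScale / 8 * ‖w x‖ ^ 4 := by positivity
  rcases hm.eq_or_lt with rfl | hm
  -- With no missing mass the two cotangents cancel. Zero total energy then forces equality in both
  -- half-line bounds.
  · have hQP : Q = Real.pi - P := by linarith
    have hcot : Real.cos Q / Real.sin Q = -(Real.cos P / Real.sin P) := by
      rw [hQP, Real.cos_pi_sub, Real.sin_pi_sub, neg_div]
    rw [hcot] at hl ⊢
    refine ⟨by linarith, fun hle => ⟨rfl, by linarith, by linarith⟩⟩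
  · have hdef := defect_le_cot_add_cot hP0 hQ0 (by nlinarith)
    have h6 : massScale * m = Real.pi - P - Q := by linarith
    rw [e, h6]
    have h7 := mul_lt_mul_of_pos_left hdef hc
    rw [mul_add] at h7
    refine ⟨by linarith, fun hle => absurd hle (by linarith)⟩

/-- Rigidity of the optimizers: `|w|²` is a hyperbolic secant. -/
theorem exists_sech (h : IsH1Line w w') {x : ℝ} (hx : 0 < ‖w x‖ ^ 2)
    (htot : massScale * ∫ y, ‖w y‖ ^ 2 = Real.pi) (hle : (∫ y, energyDensity w w' y) ≤ 0) :
    ∃ C k c : ℝ, 0 < C ∧ 0 < k ∧ ∀ y, ‖w y‖ ^ 2 = C / Real.cosh (k * (y - c)) := by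
  have hk := massScale_pos
  have htot' : massScale * ((∫ y, ‖w y‖ ^ 2) + 0) = Real.pi := by rwa [add_zero]
  obtain ⟨h1, h2, h3, h4, h5⟩ := h.scaled_masses hx le_rfl htot'
  obtain ⟨-, hR, hL⟩ := (h.le_integral_energyDensity hx le_rfl htot').2 (by simpa using hle)
  have hsP := Real.sin_pos_of_pos_of_lt_pi (mul_pos hk h1) h3
  set C := ‖w x‖ ^ 2 / Real.sin (massScale * tailMass w x) with hC
  have hC0 : 0 < C := by positivity
  -- Rigidity on the two sides of x gives one formula, because the angles on the left and on the
  -- right are supplementary and have the same sine.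
  have hsq : ∀ y, ‖w y‖ ^ 2 = C * Real.sin (massScale * tailMass w y) := by
    intro y
    rcases le_total x y with hxy | hxy
    · exact h.sq_eq_of_integral_Ioi_le h3 hR hxy
    · have := h.neg_arg.sq_eq_of_integral_Ioi_le h4 (by simpa using hL) (neg_le_neg hxy)
      simp only [neg_neg] at this
      have e : ∀ z, massScale * tailMass (fun y => w (-y)) (-z) =
          Real.pi - massScale * tailMass w z := by
        intro z; rw [h.tailMass_neg_arg z]; linarith
      rw [e x, e y, Real.sin_pi_sub, Real.sin_pi_sub] at this
      exact this
  set k := massScale * C with hkC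
  have hk0 : 0 < k := by positivity
  set t0 := Real.tan (massScale * tailMass w x / 2) with ht0
  have ht0pos : 0 < t0 := by
    refine Real.tan_pos_of_pos_of_lt_pi_div_two ?_ ?_ <;> nlinarith
  -- This centre makes the explicit profile 2 arctan(exp(-k(y - c))) agree with the scaled tail mass
  -- at x.
  set c := x + Real.log t0 / k with hc
  -- Both sides solve θ' = -k sin θ, where k is now `massScale * C`, and agree at x; the field is
  -- globally Lipschitz.
  have hode : (fun y => massScale * tailMass w y) =
      fun y => 2 * Real.arctan (Real.exp (-(k * (y - c)))) := by
    refine ODE_solution_unique_univ (v := fun _ θ => -(k * Real.sin θ)) (s := fun _ => univ)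
      (K := Real.toNNReal k) (t₀ := x) ?_ ?_ ?_ ?_
    · intro t
      refine LipschitzWith.lipschitzOnWith (LipschitzWith.of_dist_le_mul fun a b => ?_)
      rw [Real.coe_toNNReal _ hk0.le, Real.dist_eq, Real.dist_eq,
        show -(k * Real.sin a) - -(k * Real.sin b) = -k * (Real.sin a - Real.sin b) by ring,
        abs_mul, abs_neg, abs_of_pos hk0]
      have := Real.lipschitzWith_sin.dist_le_mul a b
      rw [Real.dist_eq, Real.dist_eq, NNReal.coe_one, one_mul] at this
      exact mul_le_mul_of_nonneg_left this hk0.le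
    · intro t
      refine ⟨?_, mem_univ _⟩
      refine ((h.hasDerivAt_tailMass t).const_mul massScale).congr_deriv ?_
      rw [hsq t, hkC]; ring
    · intro t
      refine ⟨?_, mem_univ _⟩
      have hd : HasDerivAt (fun y => Real.exp (-(k * (y - c))))
          (Real.exp (-(k * (t - c))) * (-(k * 1))) t :=
        (((hasDerivAt_id t).sub_const c).const_mul k).neg.exp
      refine (hd.arctan.const_mul 2).congr_deriv ?_
      rw [Real.sin_two_mul, Real.sin_arctan, Real.cos_arctan]
      have : (0 : ℝ) < 1 + Real.exp (-(k * (t - c))) ^ 2 := by positivity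
      rw [show 2 * (Real.exp (-(k * (t - c))) / √(1 + Real.exp (-(k * (t - c))) ^ 2)) *
        (1 / √(1 + Real.exp (-(k * (t - c))) ^ 2)) = 2 * Real.exp (-(k * (t - c))) /
        (√(1 + Real.exp (-(k * (t - c))) ^ 2) * √(1 + Real.exp (-(k * (t - c))) ^ 2)) by
          field_simp, Real.mul_self_sqrt this.le]
      field_simp
    · have : -(k * (x - c)) = Real.log t0 := by rw [hc]; field_simp; ring
      simp only [this]
      rw [Real.exp_log ht0pos, ht0, Real.arctan_tan]
      · ring
      · nlinarith [mul_pos hk h1]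
      · linarith
  refine ⟨C, k, c, hC0, hk0, fun y => ?_⟩
  rw [hsq y, congrFun hode y, Real.sin_two_mul, Real.sin_arctan, Real.cos_arctan, Real.cosh_eq]
  have hE := Real.exp_pos (-(k * (y - c)))
  have : (0 : ℝ) < 1 + Real.exp (-(k * (y - c))) ^ 2 := by positivity
  rw [show 2 * (Real.exp (-(k * (y - c))) / √(1 + Real.exp (-(k * (y - c))) ^ 2)) *
    (1 / √(1 + Real.exp (-(k * (y - c))) ^ 2)) = 2 * Real.exp (-(k * (y - c))) /
    (√(1 + Real.exp (-(k * (y - c))) ^ 2) * √(1 + Real.exp (-(k * (y - c))) ^ 2)) by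
      field_simp, Real.mul_self_sqrt this.le,
    show Real.exp (k * (y - c)) = (Real.exp (-(k * (y - c))))⁻¹ by rw [← Real.exp_neg, neg_neg]]
  field_simp

end IsH1Line

/-! ### Weak derivatives on intervals -/

/-- A continuously differentiable function has a weak derivative on every set. -/
theorem hasWeakDerivOn_of_hasDerivAt {f f' : ℝ → ℂ} (hf : ∀ x, HasDerivAt f (f' x) x)
    (hf' : Continuous f') (I : Set ℝ) : HasWeakDerivOn I f f' := by
  intro φ hφ hc hs
  have hsub : tsupport φ ⊆ I := hs.trans interior_subset
  have hfc : Continuous f := continuous_iff_continuousAt.2 fun x => (hf x).continuousAt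
  have hφ1 : ContDiff ℝ 1 φ := hφ.of_le (by simp)
  have hd : Continuous (deriv φ) := hφ1.continuous_deriv_one
  have h1 : ∀ x, x ∉ I → deriv φ x • f x = 0 := fun x hx => by
    rw [image_eq_zero_of_notMem_tsupport fun h => hx (hsub (tsupport_deriv_subset h)), zero_smul]
  have h2 : ∀ x, x ∉ I → φ x • f' x = 0 := fun x hx => by
    rw [image_eq_zero_of_notMem_tsupport fun h => hx (hsub h), zero_smul]
  rw [setIntegral_eq_integral_of_forall_compl_eq_zero h1,
    setIntegral_eq_integral_of_forall_compl_eq_zero h2]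
  have := integral_bilinear_hasDerivAt_right_eq_neg_left_of_integrable
    (L := ContinuousLinearMap.lsmul ℝ ℝ) (u := φ) (v := f) (u' := deriv φ) (v' := f')
    (fun x _ => (hφ1.differentiable (by simp) x).hasDerivAt) (fun x _ => hf x)
    ((hφ.continuous.smul hf').integrable_of_hasCompactSupport hc.smul_right)
    ((hd.smul hfc).integrable_of_hasCompactSupport hc.deriv.smul_right)
    ((hφ.continuous.smul hfc).integrable_of_hasCompactSupport hc.smul_right)
  simp only [ContinuousLinearMap.lsmul_apply] at this
  rw [this, neg_neg]

theorem Real.smoothTransition.deriv_eq_zero {x : ℝ} (hx : x ∉ Icc (0 : ℝ) 1) :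
    deriv Real.smoothTransition x = 0 := by
  rw [mem_Icc, not_and_or, not_le, not_le] at hx
  rcases hx with hx | hx
  · have : Real.smoothTransition =ᶠ[𝓝 x] fun _ => 0 := by
      filter_upwards [Iio_mem_nhds hx] with y hy
      exact Real.smoothTransition.zero_of_nonpos (le_of_lt hy)
    rw [this.deriv_eq, deriv_const]
  · have : Real.smoothTransition =ᶠ[𝓝 x] fun _ => 1 := by
      filter_upwards [Ioi_mem_nhds hx] with y hy
      exact Real.smoothTransition.one_of_one_le (le_of_lt hy)
    rw [this.deriv_eq, deriv_const]

theorem Real.smoothTransition.continuous_deriv : Continuous (deriv Real.smoothTransition) :=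
  (Real.smoothTransition.contDiff (n := 1)).continuous_deriv_one

theorem Real.smoothTransition.hasCompactSupport_deriv :
    HasCompactSupport (deriv Real.smoothTransition) :=
  HasCompactSupport.intro isCompact_Icc fun _ hx => Real.smoothTransition.deriv_eq_zero hx

theorem Real.smoothTransition.integral_deriv : ∫ x, deriv Real.smoothTransition x = 1 := by
  have h := integral_of_hasDerivAt_of_tendsto (f := Real.smoothTransition) (m := 0) (n := 1)
    (fun x => ((Real.smoothTransition.contDiff (n := 1)).differentiable (by simp) x).hasDerivAt)
    (Real.smoothTransition.continuous_deriv.integrable_of_hasCompactSupport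
      Real.smoothTransition.hasCompactSupport_deriv) ?_ ?_
  · simpa using h
  · refine tendsto_const_nhds.congr' ?_
    filter_upwards [eventually_le_atBot 0] with x hx
    exact (Real.smoothTransition.zero_of_nonpos hx).symm
  · refine tendsto_const_nhds.congr' ?_
    filter_upwards [eventually_ge_atTop 1] with x hx
    exact (Real.smoothTransition.one_of_one_le hx).symm

/-- Averaging a continuous function against a concentrating bump. -/
theorem tendsto_integral_deriv_smoothTransition {f : ℝ → ℂ} (hf : Continuous f) {C : ℝ}
    (hC : ∀ x, ‖f x‖ ≤ C) (c : ℝ) :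
    Tendsto (fun r => ∫ x, (r⁻¹ * deriv Real.smoothTransition ((x - c) / r)) • f x) (𝓝[>] 0)
      (𝓝 (f c)) := by
  set s := deriv Real.smoothTransition
  have hs : Continuous s := Real.smoothTransition.continuous_deriv
  have hsi : Integrable s := hs.integrable_of_hasCompactSupport
    Real.smoothTransition.hasCompactSupport_deriv
  -- After the substitution x = c + ry the bump no longer depends on r, and dominated convergence
  -- applies.
  have h1 : Tendsto (fun r : ℝ => ∫ y, s y • f (c + r * y)) (𝓝[>] 0) (𝓝 (∫ y, s y • f c)) := by
    refine tendsto_integral_filter_of_dominated_convergence (fun y => ‖s y‖ * C) ?_ ?_ ?_ ?_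
    · filter_upwards with r
      exact Continuous.aestronglyMeasurable (by fun_prop)
    · filter_upwards with r
      filter_upwards with y
      rw [norm_smul]
      exact mul_le_mul_of_nonneg_left (hC _) (norm_nonneg _)
    · exact hsi.norm.mul_const C
    · filter_upwards with y
      have : Continuous fun r : ℝ => s y • f (c + r * y) := by fun_prop
      simpa using (this.tendsto 0).mono_left nhdsWithin_le_nhds
  rw [_root_.integral_smul_const, Real.smoothTransition.integral_deriv, one_smul] at h1
  refine h1.congr' ?_
  filter_upwards [self_mem_nhdsWithin] with r hr
  have hr : 0 < r := hr
  have e1 := Measure.integral_comp_mul_left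
    (fun z => (r⁻¹ * s (z / r)) • f (c + z)) r
  have e2 := integral_add_left_eq_self (μ := volume)
    (fun x => (r⁻¹ * s ((x - c) / r)) • f x) c
  rw [← e2]
  simp only [add_sub_cancel_left]
  have e3 : ∀ x, r * x / r = x := fun x => by field_simp
  simp only [e3] at e1
  rw [abs_of_pos (inv_pos.2 hr), eq_inv_smul_iff₀ hr.ne', ← MeasureTheory.integral_smul] at e1
  rw [← e1]
  refine integral_congr_ae ?_
  filter_upwards with x
  rw [smul_smul, ← mul_assoc, mul_inv_cancel₀ hr.ne', one_mul]

/-- The fundamental theorem of calculus for weak derivatives, in the interior of the interval. -/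
theorem HasWeakDerivOn.sub_eq_of_lt {I : Set ℝ} {f g : ℝ → ℂ} (h : HasWeakDerivOn I f g)
    {a b d : ℝ} (hab : a < b) (hbd : b < d) (hI : Icc a d ⊆ interior I)
    (hf : ContinuousOn f (Icc a d)) (hg : IntegrableOn g (Icc a d)) :
    f b - f a = ∫ x in a..b, g x := by
  have had : a ≤ d := by linarith
  set f₁ : ℝ → ℂ := IccExtend had ((Icc a d).domRestrict f) with hf₁
  have hf₁c : Continuous f₁ := hf.domRestrict.Icc_extend'
  have hf₁e : ∀ x ∈ Icc a d, f₁ x = f x := fun x hx => by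
    rw [hf₁, IccExtend_of_mem _ _ hx]; rfl
  obtain ⟨C, hC⟩ : ∃ C, ∀ x, ‖f₁ x‖ ≤ C := by
    obtain ⟨C, hC⟩ := isCompact_Icc.exists_bound_of_continuousOn hf
    exact ⟨C, fun x => hC _ (projIcc a d had x).2⟩
  set S := Real.smoothTransition
  have hS : ContDiff ℝ ∞ S := Real.smoothTransition.contDiff
  have S0 : ∀ {c r x : ℝ}, 0 < r → x ≤ c → S ((x - c) / r) = 0 := fun hr hx =>
    Real.smoothTransition.zero_of_nonpos (div_nonpos_of_nonpos_of_nonneg (by linarith) hr.le)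
  have S1 : ∀ {c r x : ℝ}, 0 < r → c + r ≤ x → S ((x - c) / r) = 1 := fun hr hx =>
    Real.smoothTransition.one_of_one_le (by rw [le_div_iff₀ hr]; linarith)
  have hIJ : Icc a d ⊆ I := hI.trans interior_subset
  -- A smooth approximation of the indicator of (a, b], rising on [a, a + r] and falling on [b, b +
  -- r]. The point d leaves room to the right of b. As r tends to 0, the derivative concentrates at
  -- a and b with opposite signs.
  set φ : ℝ → ℝ → ℝ := fun r x => S ((x - a) / r) - S ((x - b) / r) with hφ
  have hφ0 : ∀ r ∈ Ioo 0 (d - b), ∀ x, x ∉ Icc a (b + r) → φ r x = 0 := by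
    intro r hr x hx
    have hr0 := hr.1
    rw [mem_Icc, not_and_or, not_le, not_le] at hx
    simp only [hφ]
    rcases hx with hx | hx
    · rw [S0 hr0 (by linarith), S0 hr0 (by linarith), sub_zero]
    · rw [S1 hr0 (by linarith), S1 hr0 (by linarith), sub_self]
  have hts : ∀ r ∈ Ioo 0 (d - b), tsupport (φ r) ⊆ Icc a d := by
    intro r hr
    refine (closure_minimal ?_ isClosed_Icc).trans
      (Icc_subset_Icc_right (show b + r ≤ d by linarith [hr.2]))
    intro x hx
    by_contra hcon
    exact hx (hφ0 r hr x hcon)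
  have hleft : Tendsto (fun r => ∫ x in I, deriv (φ r) x • f x) (𝓝[>] 0) (𝓝 (f a - f b)) := by
    have h1 := (tendsto_integral_deriv_smoothTransition hf₁c hC a).sub
      (tendsto_integral_deriv_smoothTransition hf₁c hC b)
    rw [hf₁e a ⟨le_rfl, had⟩, hf₁e b ⟨hab.le, hbd.le⟩] at h1
    refine h1.congr' ?_
    filter_upwards [Ioo_mem_nhdsGT (show (0 : ℝ) < d - b by linarith)] with r hr
    have hr0 : r ≠ 0 := hr.1.ne'
    have hint : ∀ c, Integrable fun x => (r⁻¹ * deriv S ((x - c) / r)) • f₁ x := by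
      intro c
      have hs : Continuous (deriv S) := Real.smoothTransition.continuous_deriv
      refine Continuous.integrable_of_hasCompactSupport (by fun_prop) ?_
      refine HasCompactSupport.intro (isCompact_Icc (a := c) (b := c + r)) fun x hx => ?_
      rw [show deriv S ((x - c) / r) = 0 from ?_, mul_zero, zero_smul]
      refine Real.smoothTransition.deriv_eq_zero fun hm => hx ?_
      rw [mem_Icc, le_div_iff₀ hr.1, div_le_iff₀ hr.1] at hm
      exact ⟨by linarith [hm.1], by linarith [hm.2]⟩
    rw [← integral_sub (hint a) (hint b)]
    have hder : ∀ x, deriv (φ r) x =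
        r⁻¹ * deriv S ((x - a) / r) - r⁻¹ * deriv S ((x - b) / r) := by
      intro x
      have hSd : Differentiable ℝ S := hS.differentiable (by simp)
      have h2 : ∀ c, HasDerivAt (fun x => S ((x - c) / r)) (deriv S ((x - c) / r) * (1 / r)) x :=
        fun c => (hSd _).hasDerivAt.comp x (((hasDerivAt_id x).sub_const c).div_const r)
      refine ((h2 a).sub (h2 b)).deriv.trans ?_
      ring
    have hz : ∀ x, x ∉ I → deriv (φ r) x • f₁ x = 0 := fun x hx => by
      rw [image_eq_zero_of_notMem_tsupport
        fun hm => hx (hIJ (hts r hr (tsupport_deriv_subset hm))), zero_smul]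
    have e : ∀ x, deriv (φ r) x • f x = deriv (φ r) x • f₁ x := by
      intro x
      by_cases hx : x ∈ Icc a d
      · rw [hf₁e x hx]
      · rw [image_eq_zero_of_notMem_tsupport
          fun hm => hx (hts r hr (tsupport_deriv_subset hm)), zero_smul, zero_smul]
    simp only [e]
    rw [setIntegral_eq_integral_of_forall_compl_eq_zero hz]
    refine integral_congr_ae ?_
    filter_upwards with x
    rw [hder x, sub_smul]
  have hright : Tendsto (fun r => ∫ x in I, φ r x • g x) (𝓝[>] 0) (𝓝 (∫ x in a..b, g x)) := by
    have h1 : Tendsto (fun r => ∫ x in Icc a d, φ r x • g x) (𝓝[>] 0)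
        (𝓝 (∫ x in Icc a d, (Ioc a b).indicator g x)) := by
      refine tendsto_integral_filter_of_dominated_convergence (fun x => ‖g x‖) ?_ ?_ ?_ ?_
      · filter_upwards with r
        have : Continuous (φ r) := by
          have := hS.continuous
          simp only [hφ]
          fun_prop
        exact this.aestronglyMeasurable.smul hg.aestronglyMeasurable
      · filter_upwards with r
        filter_upwards with x
        rw [norm_smul]
        refine mul_le_of_le_one_left (norm_nonneg _) ?_
        simp only [hφ, Real.norm_eq_abs]
        rw [abs_le]
        have h1 := Real.smoothTransition.nonneg ((x - a) / r)
        have h2 := Real.smoothTransition.nonneg ((x - b) / r)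
        have h3 := Real.smoothTransition.le_one ((x - a) / r)
        have h4 := Real.smoothTransition.le_one ((x - b) / r)
        exact ⟨by linarith, by linarith⟩
      · exact hg.norm
      · filter_upwards with x
        refine tendsto_const_nhds.congr' ?_
        rcases le_or_gt x a with hxa | hxa
        · filter_upwards [self_mem_nhdsWithin] with r hr
          have hr : 0 < r := hr
          rw [indicator_of_notMem fun hm => hm.1.not_ge hxa]
          simp only [hφ]
          rw [S0 hr (by linarith), S0 hr (by linarith), sub_zero, zero_smul]
        rcases le_or_gt x b with hxb | hxb
        · filter_upwards [Ioo_mem_nhdsGT (show (0 : ℝ) < x - a by linarith)] with r hr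
          rw [indicator_of_mem (show x ∈ Ioc a b from ⟨hxa, hxb⟩)]
          simp only [hφ]
          rw [S1 hr.1 (by linarith [hr.2]), S0 hr.1 hxb, sub_zero, one_smul]
        · filter_upwards [Ioo_mem_nhdsGT (show (0 : ℝ) < x - b by linarith)] with r hr
          rw [indicator_of_notMem fun hm => hm.2.not_gt hxb]
          simp only [hφ]
          rw [S1 hr.1 (by linarith [hr.2]), S1 hr.1 (by linarith [hr.2]), sub_self, zero_smul]
    rw [setIntegral_indicator measurableSet_Ioc,
      inter_eq_self_of_subset_right (show Ioc a b ⊆ Icc a d from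
        fun x hx => ⟨hx.1.le, hx.2.trans hbd.le⟩), ← integral_of_le hab.le] at h1
    refine h1.congr' ?_
    filter_upwards [Ioo_mem_nhdsGT (show (0 : ℝ) < d - b by linarith)] with r hr
    have hz : ∀ s : Set ℝ, Icc a d ⊆ s → ∀ x, x ∉ s → φ r x • g x = 0 := fun s hs x hx => by
      rw [image_eq_zero_of_notMem_tsupport fun hm => hx (hs (hts r hr hm)), zero_smul]
    rw [setIntegral_eq_integral_of_forall_compl_eq_zero (hz I hIJ),
      setIntegral_eq_integral_of_forall_compl_eq_zero (hz _ subset_rfl)]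
  have heq : f a - f b = -∫ x in a..b, g x := by
    refine tendsto_nhds_unique hleft ?_
    refine hright.neg.congr' ?_
    filter_upwards [Ioo_mem_nhdsGT (show (0 : ℝ) < d - b by linarith)] with r hr
    refine (h (φ r) ?_ ?_ ?_).symm
    · simp only [hφ]
      fun_prop
    · exact HasCompactSupport.intro isCompact_Icc (hφ0 r hr)
    · exact (hts r hr).trans hI
  rw [← neg_sub, heq, neg_neg]

/-- The fundamental theorem of calculus for weak derivatives in `L²`. -/
theorem HasWeakDerivOn.sub_eq {I : Set ℝ} {f g : ℝ → ℂ} (h : HasWeakDerivOn I f g)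
    (hm : MeasurableSet I) [hI : I.OrdConnected] (hcl : I ⊆ closure (interior I))
    (hf : ContinuousOn f I) (hg : MemLp g 2 (volume.restrict I)) {a b : ℝ} (ha : a ∈ I)
    (hb : b ∈ I) : IntervalIntegrable g volume a b ∧ f b - f a = ∫ x in a..b, g x := by
  have hli : LocallyIntegrable (I.indicator g) :=
    ((memLp_indicator_iff_restrict hm).2 hg).locallyIntegrable (by norm_num)
  have hii : ∀ a b, IntervalIntegrable (I.indicator g) volume a b := fun a b =>
    intervalIntegrable_iff.mpr <|
      (hli.integrableOn_isCompact isCompact_uIcc).mono_set uIoc_subset_uIcc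
  have heq : ∀ {a b : ℝ}, a ∈ I → b ∈ I → EqOn (I.indicator g) g (uIcc a b) := fun ha hb x hx =>
    indicator_of_mem (hI.uIcc_subset ha hb hx) g
  have hin : (interior I).OrdConnected := hI.interior
  -- This difference is constant in the interior, where test functions live, and then up to the
  -- endpoints by continuity.
  set D : ℝ → ℂ := fun x => f x - ∫ t in a..x, I.indicator g t with hD
  have hDc : ContinuousOn D I := hf.sub (continuous_primitive hii a).continuousOn
  have hlt : ∀ x ∈ interior I, ∀ y ∈ interior I, x < y → D x = D y := by
    intro x hx y hy hxy
    obtain ⟨ε, hε, hball⟩ := Metric.isOpen_iff.1 isOpen_interior y hy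
    have hd : y + ε / 2 ∈ interior I := hball (by
      rw [Metric.mem_ball, Real.dist_eq]; rw [abs_of_pos] <;> linarith)
    have hsub : Icc x (y + ε / 2) ⊆ interior I := hin.out hx hd
    have hsub' := hsub.trans interior_subset
    have h1 := h.sub_eq_of_lt hxy (by linarith) hsub (hf.mono hsub')
      ((integrableOn_congr_fun (fun t ht => indicator_of_mem (hsub' ht) g)
        measurableSet_Icc).1 (hli.integrableOn_isCompact isCompact_Icc))
    have h2 := integral_interval_sub_left (hii a y) (hii a x)
    rw [intervalIntegral.integral_congr (heq (interior_subset hx) (interior_subset hy)), ← h1] at h2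
    simp only [hD]
    linear_combination h2
  have hconst : ∀ x ∈ interior I, ∀ y ∈ interior I, D x = D y := by
    intro x hx y hy
    rcases lt_trichotomy x y with hxy | rfl | hxy
    · exact hlt x hx y hy hxy
    · rfl
    · exact (hlt y hy x hx hxy).symm
  have hne : (interior I).Nonempty := closure_nonempty_iff.1 ⟨a, hcl ha⟩
  obtain ⟨c, hc⟩ := hne
  have hE : EqOn D (fun _ => D c) I := Set.EqOn.of_subset_closure
    (fun x hx => hconst x hx c hc) hDc continuousOn_const interior_subset hcl
  refine ⟨(hii a b).congr fun x hx => heq ha hb (uIoc_subset_uIcc hx), ?_⟩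
  have h1 := (hE hb).trans (hE ha).symm
  simp only [hD, integral_same, sub_zero] at h1
  rw [← intervalIntegral.integral_congr (heq ha hb)]
  linear_combination h1

namespace MetricGraph

variable {V E H : Type*} (G : MetricGraph V E H)

theorem measurableSet_interval (e : E ⊕ H) : MeasurableSet (G.interval e) := by
  cases e
  · exact measurableSet_Icc
  · exact measurableSet_Ici

theorem ordConnected_interval (e : E ⊕ H) : (G.interval e).OrdConnected := by
  cases e
  · exact ordConnected_Icc
  · exact ordConnected_Ici

theorem zero_mem_interval (e : E ⊕ H) : (0 : ℝ) ∈ G.interval e := by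
  cases e with
  | inl e => exact ⟨le_rfl, (G.len_pos e).le⟩
  | inr h => exact self_mem_Ici

theorem isClosed_interval (e : E ⊕ H) : IsClosed (G.interval e) := by
  cases e
  · exact isClosed_Icc
  · exact isClosed_Ici

theorem interval_subset_closure_interior (e : E ⊕ H) :
    G.interval e ⊆ closure (interior (G.interval e)) := by
  cases e with
  | inl e => simp [interval, interior_Icc, closure_Ioo (G.len_pos e).ne]
  | inr h => simp [interval, closure_Ioi]

variable {G}

theorem H1.sub_eq (u : G.H1) (e : E ⊕ H) {a b : ℝ} (ha : a ∈ G.interval e)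
    (hb : b ∈ G.interval e) : IntervalIntegrable (u.weakDeriv e) volume a b ∧
      u.toFun e b - u.toFun e a = ∫ x in a..b, u.weakDeriv e x :=
  have := G.ordConnected_interval e
  (u.hasWeakDerivOn e).sub_eq (G.measurableSet_interval e) (G.interval_subset_closure_interior e)
    (u.continuousOn e) (u.memLp_weakDeriv e) ha hb

end MetricGraph

/-! ### Tilings of the line by edges -/

theorem measurableEmbedding_add_mul {ε : ℝ} (hε : ε = 1 ∨ ε = -1) (b : ℝ) :
    MeasurableEmbedding fun t : ℝ => b + ε * t := by
  rcases hε with rfl | rfl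
  · simpa using (Homeomorph.addLeft b).measurableEmbedding
  · convert! ((Homeomorph.neg ℝ).trans (Homeomorph.addLeft b)).measurableEmbedding using 1
    ext t; simp

theorem measurePreserving_add_mul {ε : ℝ} (hε : ε = 1 ∨ ε = -1) (b : ℝ) :
    MeasurePreserving (fun t : ℝ => b + ε * t) volume volume := by
  rcases hε with rfl | rfl
  · simpa using measurePreserving_add_left volume b
  · have := (measurePreserving_add_left volume b).comp (Measure.measurePreserving_neg volume)
    convert! this using 1
    ext t; simp

namespace MetricGraph

variable {V E H : Type*} {G : MetricGraph V E H}

theorem IsEnd.mem_interval {e : E ⊕ H} {t : ℝ} {v : V} (h : G.IsEnd e t v) : t ∈ G.interval e := by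
  cases e with
  | inl e =>
    have := (G.len_pos e).le
    rcases h with ⟨rfl, -⟩ | ⟨rfl, -⟩
    · exact ⟨le_rfl, this⟩
    · exact ⟨this, le_rfl⟩
  | inr k =>
    obtain ⟨rfl, -⟩ := h
    exact self_mem_Ici

theorem IsEnd.unique {e : E ⊕ H} {t : ℝ} {v v' : V} (h : G.IsEnd e t v) (h' : G.IsEnd e t v') :
    v = v' := by
  cases e with
  | inl e =>
    have := (G.len_pos e).ne
    simp only [IsEnd] at h h'
    grind
  | inr k => exact h.2.trans h'.2.symm

variable (G) in
theorem finite_setOf_isEnd (e : E ⊕ H) : {t | ∃ v, G.IsEnd e t v}.Finite := by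
  cases e with
  | inl e =>
    refine (Set.toFinite {0, G.len e}).subset ?_
    rintro t ⟨v, ⟨rfl, -⟩ | ⟨rfl, -⟩⟩ <;> simp
  | inr k =>
    refine (Set.toFinite {0}).subset ?_
    rintro t ⟨v, rfl, -⟩
    simp

variable (G) in
theorem exists_isEnd_zero (e : E ⊕ H) : ∃ v, G.IsEnd e 0 v := by
  cases e with
  | inl e => exact ⟨G.src e, .inl ⟨rfl, rfl⟩⟩
  | inr k => exact ⟨G.base k, rfl, rfl⟩

theorem SamePoint.symm {e e' : E ⊕ H} {t t' : ℝ} (h : G.SamePoint e t e' t') :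
    G.SamePoint e' t' e t := by
  rcases h with ⟨rfl, rfl⟩ | ⟨v, h, h'⟩
  · exact .inl ⟨rfl, rfl⟩
  · exact .inr ⟨v, h', h⟩

theorem SamePoint.trans {e e' e'' : E ⊕ H} {t t' t'' : ℝ} (h : G.SamePoint e t e' t')
    (h' : G.SamePoint e' t' e'' t'') : G.SamePoint e t e'' t'' := by
  rcases h with ⟨rfl, rfl⟩ | ⟨v, h1, h2⟩
  · exact h'
  · rcases h' with ⟨rfl, rfl⟩ | ⟨v', h3, h4⟩
    · exact .inr ⟨v, h1, h2⟩
    · obtain rfl := h2.unique h3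
      exact .inr ⟨v, h1, h4⟩

theorem H1.eq_of_samePoint (u : G.H1) {e e' : E ⊕ H} {t t' : ℝ} (h : G.SamePoint e t e' t') :
    u.toFun e t = u.toFun e' t' := by
  rcases h with ⟨rfl, rfl⟩ | ⟨v, h, h'⟩
  · rfl
  · obtain ⟨val, hval⟩ := u.continuous_vertex
    rw [hval _ _ _ h, hval _ _ _ h']

/-- The affine maps `t ↦ b e + ε e * t` lay the edges of the set `L` one after the other on the
set `I` of real numbers, in such a way that two edges can only overlap at a common vertex. -/
structure IsTiling (G : MetricGraph V E H) (L : Set (E ⊕ H)) (ε b : E ⊕ H → ℝ) (I : Set ℝ) :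
    Prop where
  sign : ∀ e ∈ L, ε e = 1 ∨ ε e = -1
  mem : ∀ e ∈ L, ∀ t ∈ G.interval e, b e + ε e * t ∈ I
  exists_eq : ∀ x ∈ I, ∃ e ∈ L, ∃ t ∈ G.interval e, b e + ε e * t = x
  samePoint : ∀ e ∈ L, ∀ t ∈ G.interval e, ∀ e' ∈ L, ∀ t' ∈ G.interval e',
    b e + ε e * t = b e' + ε e' * t' → G.SamePoint e t e' t'

namespace IsTiling

theorem single {e : E ⊕ H} {δ c : ℝ} (hδ : δ = 1 ∨ δ = -1) {I : Set ℝ}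
    (hI : (fun t => c + δ * t) '' G.interval e = I) :
    G.IsTiling {e} (fun _ => δ) (fun _ => c) I where
  sign _ _ := hδ
  mem := by
    rintro e' rfl t ht
    exact hI ▸ mem_image_of_mem _ ht
  exists_eq x hx := by
    obtain ⟨t, ht, rfl⟩ := hI.symm ▸ hx
    exact ⟨e, rfl, t, ht, rfl⟩
  samePoint := by
    rintro e₁ rfl t _ e₂ rfl t' _ h
    refine .inl ⟨rfl, ?_⟩
    rcases hδ with rfl | rfl <;> linarith

theorem shift {L : Set (E ⊕ H)} {ε b : E ⊕ H → ℝ} {I : Set ℝ} (h : G.IsTiling L ε b I) (c : ℝ) :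
    G.IsTiling L ε (fun e => b e + c) ((fun x => x - c) ⁻¹' I) where
  sign := h.sign
  mem e he t ht := by
    have := h.mem e he t ht
    rw [mem_preimage]
    convert this using 1
    ring
  exists_eq x hx := by
    obtain ⟨e, he, t, ht, h1⟩ := h.exists_eq _ hx
    exact ⟨e, he, t, ht, by linarith⟩
  samePoint e he t ht e' he' t' ht' heq := h.samePoint e he t ht e' he' t' ht' (by linarith)

-- Disjoint families of edges keep their own placements; the only new compatibility to check is
-- where an edge of one family meets an edge of the other.
open Classical in
theorem union {L₁ L₂ : Set (E ⊕ H)} {ε₁ b₁ ε₂ b₂ : E ⊕ H → ℝ} {I₁ I₂ : Set ℝ}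
    (h₁ : G.IsTiling L₁ ε₁ b₁ I₁) (h₂ : G.IsTiling L₂ ε₂ b₂ I₂) (hd : ∀ e ∈ L₂, e ∉ L₁)
    (hc : ∀ e ∈ L₁, ∀ t ∈ G.interval e, ∀ e' ∈ L₂, ∀ t' ∈ G.interval e',
      b₁ e + ε₁ e * t = b₂ e' + ε₂ e' * t' → G.SamePoint e t e' t') :
    G.IsTiling (L₁ ∪ L₂) (fun e => if e ∈ L₁ then ε₁ e else ε₂ e)
      (fun e => if e ∈ L₁ then b₁ e else b₂ e) (I₁ ∪ I₂) where
  sign := by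
    rintro e (he | he)
    · simpa [he] using h₁.sign e he
    · simpa [hd e he] using h₂.sign e he
  mem := by
    rintro e (he | he) t ht
    · simpa [he] using .inl (h₁.mem e he t ht)
    · simpa [hd e he] using .inr (h₂.mem e he t ht)
  exists_eq := by
    rintro x (hx | hx)
    · obtain ⟨e, he, t, ht, rfl⟩ := h₁.exists_eq x hx
      exact ⟨e, .inl he, t, ht, by simp [he]⟩
    · obtain ⟨e, he, t, ht, rfl⟩ := h₂.exists_eq x hx
      exact ⟨e, .inr he, t, ht, by simp [hd e he]⟩
  samePoint := by
    rintro e (he | he) t ht e' (he' | he') t' ht' heq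
    · exact h₁.samePoint e he t ht e' he' t' ht' (by simpa [he, he'] using heq)
    · exact hc e he t ht e' he' t' ht' (by simpa [he, hd e' he'] using heq)
    · exact (hc e' he' t' ht' e he t ht (by simpa [he', hd e he] using heq.symm)).symm
    · exact h₂.samePoint e he t ht e' he' t' ht' (by simpa [hd e he, hd e' he'] using heq)

end IsTiling

open Classical in
/-- The edges of a ray tile the half-line. -/
theorem Ray.exists_isTiling {a : V} {r : List (E ⊕ H)} (h : G.Ray a r) (hnd : r.Nodup) :
    ∃ ε b, G.IsTiling {e | e ∈ r} ε b (Ici 0) ∧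
      ∀ e ∈ r, ∀ t ∈ G.interval e, b e + ε e * t = 0 → G.IsEnd e t a := by
  induction h with
  | last k =>
    refine ⟨fun _ => 1, fun _ => 0, ?_, ?_⟩
    · simpa using IsTiling.single (G := G) (e := .inr k) (c := 0) (.inl rfl) (by simp [interval])
    · simp [IsEnd]
  | @cons e a a' l hj _ ih =>
    rw [List.nodup_cons] at hnd
    obtain ⟨ε, b, hT, hend⟩ := ih hnd.2
    have hT' := hT.shift (G.len e)
    have hlen := G.len_pos e
    -- The edge is laid on [0, ℓ] in the direction of the trail, reversed if it is traversed from
    -- its target to its source.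
    obtain ⟨δ, c, hδ, himg, h0, h1⟩ : ∃ δ c : ℝ, (δ = 1 ∨ δ = -1) ∧
        (fun t => c + δ * t) '' G.interval (.inl e) = Icc 0 (G.len e) ∧
        (∀ t ∈ G.interval (.inl e), c + δ * t = 0 → G.IsEnd (.inl e) t a) ∧
        (∀ t ∈ G.interval (.inl e), c + δ * t = G.len e → G.IsEnd (.inl e) t a') := by
      simp only [Joins, Option.some.injEq] at hj
      rcases hj with ⟨rfl, rfl⟩ | ⟨rfl, rfl⟩
      · refine ⟨1, 0, .inl rfl, by simp [interval], ?_, ?_⟩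
        · exact fun t _ h => .inl ⟨by linarith, rfl⟩
        · exact fun t _ h => .inr ⟨by linarith, rfl⟩
      · refine ⟨-1, G.len e, .inr rfl, ?_, ?_, ?_⟩
        · ext x
          simp only [interval, mem_image, mem_Icc]
          constructor
          · rintro ⟨t, ht, rfl⟩; constructor <;> linarith
          · rintro hx; exact ⟨G.len e - x, ⟨by linarith, by linarith⟩, by ring⟩
        · exact fun t _ h => .inr ⟨by linarith, rfl⟩
        · exact fun t _ h => .inl ⟨by linarith, rfl⟩
    have hne : ∀ e' ∈ {e' | e' ∈ l}, e' ∉ ({.inl e} : Set (E ⊕ H)) := by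
      rintro e' he' rfl
      exact hnd.1 he'
    -- The rest of the ray occupies [ℓ, ∞), so it meets the first edge only at ℓ. The induction
    -- carries the fact that whatever lies at the origin of a ray is its initial vertex, which
    -- identifies the two sides as a'.
    have hU := (IsTiling.single hδ himg).union hT' hne ?_
    · have e1 : ({.inl e} ∪ {e' | e' ∈ l} : Set (E ⊕ H)) = {e' | e' ∈ .inl e :: l} := by
        ext; simp
      have e2 : Icc 0 (G.len e) ∪ (fun x => x - G.len e) ⁻¹' Ici 0 = Ici 0 := by
        ext x
        simp only [mem_union, mem_Icc, mem_preimage, mem_Ici]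
        constructor
        · rintro (h | h) <;> linarith
        · intro h
          rcases le_total x (G.len e) with h' | h'
          · exact .inl ⟨h, h'⟩
          · exact .inr (by linarith)
      rw [e1, e2] at hU
      refine ⟨_, _, hU, ?_⟩
      intro e' he' t ht heq
      rcases List.mem_cons.1 he' with rfl | he'
      · exact h0 t ht (by simpa using heq)
      · have h2 := hT.mem e' he' t ht
        have h3 := hne e' he'
        simp only [h3, if_false] at heq
        rw [mem_Ici] at h2
        linarith
    · rintro e₁ rfl t ht e' he' t' ht' heq
      have h2 := hT.mem e' he' t' ht'
      have h3 : c + δ * t ∈ Icc 0 (G.len e) := himg ▸ mem_image_of_mem _ ht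
      rw [mem_Ici] at h2
      exact .inr ⟨a', h1 t ht (by linarith [h3.2]), hend e' he' t' ht' (by linarith [h3.2])⟩

/-- Under the assumption of a cycle covering, each edge lies on a line in the graph. -/
theorem HasCycleCovering.exists_isTiling [Nonempty H] (hH : G.HasCycleCovering)
    (hconn : G.Connected) (c : E ⊕ H) : ∃ L ε b, G.IsTiling L ε b univ ∧ c ∈ L := by
  classical
  obtain ⟨h, r, hr, hnd, hc⟩ := hH.exists_line hconn c
  rw [List.nodup_cons] at hnd
  obtain ⟨ε, b, hT, hend⟩ := hr.exists_isTiling hnd.2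
  have himg : (fun t => 0 + -1 * t) '' G.interval (.inr h : E ⊕ H) = Iic 0 := by
    ext x
    simp only [interval, mem_image, mem_Ici, mem_Iic]
    constructor
    · rintro ⟨t, ht, rfl⟩; linarith
    · intro hx; exact ⟨-x, by linarith, by ring⟩
  have hU := (IsTiling.single (G := G) (e := .inr h) (.inr rfl) himg).union hT
    (by rintro e' he' rfl; exact hnd.1 he') ?_
  · rw [Iic_union_Ici] at hU
    exact ⟨_, _, _, hU, by simpa using hc⟩
  · rintro e₁ rfl t ht e' he' t' ht' heq
    have h2 := hT.mem e' he' t' ht'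
    have h3 : (0 : ℝ) ≤ t := ht
    rw [mem_Ici] at h2
    exact .inr ⟨G.base h, ⟨by linarith, rfl⟩, hend e' he' t' ht' (by linarith)⟩

namespace IsTiling

variable {L : Set (E ⊕ H)} {ε b : E ⊕ H → ℝ}

theorem iUnion_image (h : G.IsTiling L ε b univ) :
    ⋃ e : L, (fun t => b e + ε e * t) '' G.interval e = univ := by
  refine eq_univ_of_forall fun x => ?_
  obtain ⟨e, he, t, ht, rfl⟩ := h.exists_eq x (mem_univ x)
  exact mem_iUnion.2 ⟨⟨e, he⟩, mem_image_of_mem _ ht⟩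

/-- Overlapping points of two different edges are vertices, and an edge has finitely many endpoints.
-/
theorem aedisjoint {I : Set ℝ} (h : G.IsTiling L ε b I) :
    Pairwise (Function.onFun (AEDisjoint volume)
      fun e : L => (fun t => b e + ε e * t) '' G.interval e) := by
  rintro ⟨e, he⟩ ⟨e', he'⟩ hne
  refine measure_mono_null ?_
    (((G.finite_setOf_isEnd e).image fun t => b e + ε e * t).measure_zero volume)
  rintro x ⟨⟨t, ht, rfl⟩, ⟨t', ht', heq⟩⟩
  rcases h.samePoint e he t ht e' he' t' ht' heq.symm with ⟨rfl, -⟩ | ⟨v, hv, -⟩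
  · exact absurd rfl hne
  · exact mem_image_of_mem _ ⟨v, hv⟩

theorem integrable_iff [Finite E] [Finite H] (h : G.IsTiling L ε b univ) {F : ℝ → ℝ} :
    Integrable F ↔ ∀ e ∈ L, IntegrableOn (fun t => F (b e + ε e * t)) (G.interval e) := by
  rw [← integrableOn_univ, ← h.iUnion_image, integrableOn_finite_iUnion]
  have key : ∀ e : L, IntegrableOn F ((fun t => b e + ε e * t) '' G.interval e) ↔
      IntegrableOn (fun t => F (b e + ε e * t)) (G.interval e) := fun e =>
    (measurePreserving_add_mul (h.sign e e.2) (b e)).integrableOn_image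
      (measurableEmbedding_add_mul (h.sign e e.2) (b e))
  exact ⟨fun hF e he => (key ⟨e, he⟩).1 (hF ⟨e, he⟩), fun hF e => (key e).2 (hF e e.2)⟩

theorem aestronglyMeasurable [Finite E] [Finite H] {F : ℝ → ℂ} (h : G.IsTiling L ε b univ)
    (hF : ∀ e ∈ L, AEStronglyMeasurable (fun t => F (b e + ε e * t))
      (volume.restrict (G.interval e))) : AEStronglyMeasurable F := by
  rw [← Measure.restrict_univ (μ := volume), ← h.iUnion_image, aestronglyMeasurable_iUnion_iff]
  intro e
  have h1 := (measurePreserving_add_mul (h.sign e e.2) (b e)).restrict_image_emb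
    (measurableEmbedding_add_mul (h.sign e e.2) (b e)) (G.interval e)
  exact (h1.aestronglyMeasurable_comp_iff
    (measurableEmbedding_add_mul (h.sign e e.2) (b e))).1 (hF e e.2)

end IsTiling

open Classical in
theorem IsTiling.integral_eq [Fintype E] [Fintype H] {L : Set (E ⊕ H)} {ε b : E ⊕ H → ℝ}
    (h : G.IsTiling L ε b univ) {F : ℝ → ℝ} (hF : Integrable F) :
    ∫ x, F x = ∑ e with e ∈ L, ∫ t in G.interval e, F (b e + ε e * t) := by
  have hm : ∀ e : L, MeasurableSet ((fun t => b e + ε e * t) '' G.interval e) := fun e =>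
    (measurableEmbedding_add_mul (h.sign e e.2) (b e)).measurableSet_image.2
      (G.measurableSet_interval e)
  rw [← setIntegral_univ, ← h.iUnion_image, integral_iUnion_ae (fun e => (hm e).nullMeasurableSet)
    h.aedisjoint hF.integrableOn, tsum_fintype]
  rw [Finset.sum_subtype (p := fun e => e ∈ L) (F := inferInstance) _ (by simp)]
  refine Finset.sum_congr rfl fun e _ => ?_
  exact (measurePreserving_add_mul (h.sign e e.2) (b e)).setIntegral_image_emb
    (measurableEmbedding_add_mul (h.sign e e.2) (b e)) _ _

end MetricGraph

/-! ### Restriction of functions on the graph to a line -/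

namespace MetricGraph

variable {V E H : Type*} {G : MetricGraph V E H}

theorem H1.integrableOn_sq (u : G.H1) (e : E ⊕ H) :
    IntegrableOn (fun t => ‖u.toFun e t‖ ^ 2) (G.interval e) :=
  (u.memLp e).integrable_norm_pow (by simp)

theorem H1.integrableOn_weakDeriv_sq (u : G.H1) (e : E ⊕ H) :
    IntegrableOn (fun t => ‖u.weakDeriv e t‖ ^ 2) (G.interval e) :=
  (u.memLp_weakDeriv e).integrable_norm_pow (by simp)

/-- A function in `H¹(𝒢)` restricts to a function in `H¹(ℝ)` along a line in the graph. -/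
theorem IsTiling.exists_isH1Line [Finite E] [Finite H] {L : Set (E ⊕ H)} {ε b : E ⊕ H → ℝ}
    (h : G.IsTiling L ε b univ) (u : G.H1) :
    ∃ w w' : ℝ → ℂ, IsH1Line w w' ∧
      (∀ e ∈ L, ∀ t ∈ G.interval e, w (b e + ε e * t) = u.toFun e t) ∧
      ∀ e ∈ L, ∀ᵐ t ∂volume.restrict (G.interval e),
        w' (b e + ε e * t) = (ε e : ℂ) * u.weakDeriv e t := by
  choose p hpL s hs hps using fun x => h.exists_eq x (mem_univ x)
  set w : ℝ → ℂ := fun x => u.toFun (p x) (s x) with hw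
  set w' : ℝ → ℂ := fun x => (ε (p x) : ℂ) * u.weakDeriv (p x) (s x) with hw'
  have hwe : ∀ e ∈ L, ∀ t ∈ G.interval e, w (b e + ε e * t) = u.toFun e t := by
    intro e he t ht
    exact u.eq_of_samePoint (h.samePoint _ (hpL _) _ (hs _) e he t ht (hps _))
  have hwe' : ∀ e ∈ L, ∀ᵐ t ∂volume.restrict (G.interval e),
      w' (b e + ε e * t) = (ε e : ℂ) * u.weakDeriv e t := by
    intro e he
    have hnull : ∀ᵐ t ∂volume.restrict (G.interval e), t ∉ {t | ∃ v, G.IsEnd e t v} :=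
      ae_restrict_of_ae ((G.finite_setOf_isEnd e).measure_zero volume |> measure_eq_zero_iff_ae_notMem.1)
    filter_upwards [hnull, ae_restrict_mem (G.measurableSet_interval e)] with t ht htI
    -- Away from the endpoints a point lies on a single edge, so the arbitrary choice of edge and
    -- coordinate does not matter.
    rcases h.samePoint e he t htI _ (hpL _) _ (hs _) (hps (b e + ε e * t)).symm with ⟨h1, h2⟩ | ⟨v, hv, -⟩
    · simp only [hw']
      rw [← h1, ← h2]
    · exact absurd ⟨v, hv⟩ ht
  have hnorm : ∀ e ∈ L, ‖(ε e : ℂ)‖ = 1 := by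
    intro e he
    rcases h.sign e he with h1 | h1 <;> simp [h1]
  have hisq : Integrable fun x => ‖w x‖ ^ 2 := by
    refine h.integrable_iff.2 fun e he => (u.integrableOn_sq e).congr_fun (fun t ht => ?_)
      (G.measurableSet_interval e)
    simp only [hwe e he t ht]
  have hisq' : Integrable fun x => ‖w' x‖ ^ 2 := by
    refine h.integrable_iff.2 fun e he => (u.integrableOn_weakDeriv_sq e).congr ?_
    filter_upwards [hwe' e he] with t ht
    rw [ht, norm_mul, hnorm e he, one_mul]
  have hmeas : AEStronglyMeasurable w' := by
    refine h.aestronglyMeasurable fun e he => ?_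
    refine ((u.memLp_weakDeriv e).aestronglyMeasurable.const_mul (ε e : ℂ)).congr ?_
    filter_upwards [hwe' e he] with t ht using ht.symm
  have hloc : LocallyIntegrable w' :=
    ((memLp_two_iff_integrable_sq_norm hmeas).2 hisq').locallyIntegrable (by norm_num)
  have hii : ∀ a c, IntervalIntegrable w' volume a c := fun a c =>
    intervalIntegrable_iff.mpr <|
      (hloc.integrableOn_isCompact isCompact_uIcc).mono_set uIoc_subset_uIcc
  have hclosed : ∀ e : L, IsClosed ((fun t => b e + ε e * t) '' G.interval e) := by
    intro e
    have : (fun t => b e + ε e * t) '' G.interval e =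
        (fun x => ε e * (x - b e)) ⁻¹' G.interval e := by
      ext x
      have h2 : ε e * ε e = 1 := by rcases h.sign e e.2 with h1 | h1 <;> simp [h1]
      constructor
      · rintro ⟨t, ht, rfl⟩
        simp only [mem_preimage, add_sub_cancel_left, ← mul_assoc, h2, one_mul]
        exact ht
      · intro hx
        exact ⟨_, hx, by linear_combination (x - b e) * h2⟩
    rw [this]
    exact (G.isClosed_interval e).preimage (by fun_prop)
  have hwc : Continuous w := by
    refine (locallyFinite_of_finite _).continuous h.iUnion_image hclosed fun e => ?_
    have h2 : ε e * ε e = 1 := by rcases h.sign e e.2 with h1 | h1 <;> simp [h1]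
    have h3 : ContinuousOn (fun x => u.toFun e (ε e * (x - b e)))
        ((fun t => b e + ε e * t) '' G.interval e) := by
      refine (u.continuousOn e).comp (by fun_prop) ?_
      rintro x ⟨t, ht, rfl⟩
      simp only [add_sub_cancel_left, ← mul_assoc, h2, one_mul]
      exact ht
    refine h3.congr ?_
    rintro x ⟨t, ht, rfl⟩
    simp only [add_sub_cancel_left, ← mul_assoc, h2, one_mul]
    exact hwe e e.2 t ht
  have hedge : ∀ e ∈ L, ∀ t ∈ G.interval e,
      w (b e + ε e * t) - w (b e + ε e * 0) = ∫ x in (b e + ε e * 0)..(b e + ε e * t), w' x := by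
    intro e he t ht
    have h0 := G.zero_mem_interval e
    have := G.ordConnected_interval e
    rw [hwe e he t ht, hwe e he 0 h0, (u.sub_eq e h0 ht).2, ← smul_integral_comp_add_mul,
      ← intervalIntegral.integral_smul]
    refine integral_congr_ae ?_
    have h1 := (ae_restrict_iff' (G.measurableSet_interval e)).1 (hwe' e he)
    filter_upwards [h1] with y hy hym
    rw [hy (this.uIcc_subset h0 ht (uIoc_subset_uIcc hym)), Complex.real_smul, ← mul_assoc,
      ← Complex.ofReal_mul]
    rcases h.sign e he with h1 | h1 <;> simp [h1]
  refine ⟨w, w', ⟨hii, ?_, hisq, hisq'⟩, hwe, hwe'⟩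
  set D : ℝ → ℂ := fun x => w x - ∫ y in (0 : ℝ)..x, w' y with hD
  have hDc : Continuous D := hwc.sub (continuous_primitive hii 0)
  have hDe : ∀ e ∈ L, ∀ t ∈ G.interval e, D (b e + ε e * t) = D (b e + ε e * 0) := by
    intro e he t ht
    have h1 := hedge e he t ht
    rw [← integral_interval_sub_left (hii 0 _) (hii 0 _)] at h1
    simp only [hD]
    linear_combination h1
  -- On each edge, w minus the primitive of w' is constant. It is continuous on the line with
  -- finitely many values, hence constant; no ordering of the edges is needed.
  have hfin : (range fun e : L => D (b e + ε e * 0)).Finite := finite_range _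
  obtain ⟨y, -, hy⟩ := isPreconnected_univ.eqOn_const_of_mapsTo hfin.isDiscrete hDc.continuousOn
    (by
      intro x _
      obtain ⟨e, he, t, ht, rfl⟩ := h.exists_eq x (mem_univ x)
      exact ⟨⟨e, he⟩, (hDe e he t ht).symm⟩)
    ⟨_, ⟨⟨p 0, hpL 0⟩, rfl⟩⟩
  intro a c
  have h1 := (hy (mem_univ a)).trans (hy (mem_univ c)).symm
  rw [← integral_interval_sub_left (hii 0 _) (hii 0 _)]
  simp only [hD] at h1
  linear_combination -h1

end MetricGraph

/-- |w|² is continuous and tends to 0 at both ends. -/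
theorem IsH1Line.exists_max {w w' : ℝ → ℂ} (h : IsH1Line w w') :
    ∃ x, ∀ y, ‖w y‖ ^ 2 ≤ ‖w x‖ ^ 2 := by
  by_cases h0 : ∀ y, ‖w y‖ ^ 2 ≤ 0
  · exact ⟨0, fun y => (h0 y).trans (by positivity)⟩
  · push Not at h0
    obtain ⟨x, hx⟩ := h0
    have hbot : Tendsto (fun x => ‖w x‖ ^ 2) atBot (𝓝 0) := by
      simpa [Function.comp_def] using h.neg_arg.tendsto_sq_atTop.comp tendsto_neg_atBot_atTop
    have hco : Tendsto (fun x => ‖w x‖ ^ 2) (cocompact ℝ) (𝓝 0) := by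
      rw [cocompact_eq_atBot_atTop]
      exact hbot.sup h.tendsto_sq_atTop
    have hc : Continuous fun x => ‖w x‖ ^ 2 := by have := h.continuous; fun_prop
    exact hc.exists_forall_ge' x ((hco.eventually (gt_mem_nhds hx)).mono fun _ h => h.le)

/-! ### Rigidity and the main estimate on the graph -/

namespace MetricGraph

variable {V E H : Type*} {G : MetricGraph V E H}

/-- If `|u|²` is a hyperbolic secant in the coordinate of a tiling by all the edges, then the graph
is the line or a tower of bubbles. -/
theorem IsTiling.isFoldedLine [Finite E] [Finite H] {ε b : E ⊕ H → ℝ}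
    (h : G.IsTiling univ ε b univ) {u : G.H1} {C k c : ℝ} (hC : 0 < C) (hk : 0 < k)
    (hu : ∀ e, ∀ t ∈ G.interval e,
      ‖u.toFun e t‖ ^ 2 = C / Real.cosh (k * (b e + ε e * t - c))) :
    G.IsRealLine ∨ G.IsTowerOfBubbles := by
  set σ : E ⊕ H → ℝ → ℝ := fun e t => b e + ε e * t - c with hσ
  set S : Set ℝ := {s | 0 < s ∧ ∃ e, ∃ t ∈ G.interval e, ∃ e', ∃ t' ∈ G.interval e',
    G.SamePoint e t e' t' ∧ σ e t = s ∧ σ e' t' = -s} with hS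
  have hsame : ∀ e, ∀ t ∈ G.interval e, ∀ e', ∀ t' ∈ G.interval e', σ e t = σ e' t' →
      G.SamePoint e t e' t' := by
    intro e t ht e' t' ht' heq
    exact h.samePoint e (mem_univ e) t ht e' (mem_univ e') t' ht' (by simp only [hσ] at heq; linarith)
  -- Continuity of u forces equal values of the secant at identified points, hence coordinates that
  -- are equal or opposite about the centre.
  have habs : ∀ e, ∀ t ∈ G.interval e, ∀ e', ∀ t' ∈ G.interval e', G.SamePoint e t e' t' →
      σ e t = σ e' t' ∨ σ e t = -σ e' t' := by
    intro e t ht e' t' ht' hs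
    have h1 := hu e t ht
    rw [u.eq_of_samePoint hs, hu e' t' ht'] at h1
    have h2 := Real.cosh_pos (k * (b e + ε e * t - c))
    have h3 := Real.cosh_pos (k * (b e' + ε e' * t' - c))
    have h4 : Real.cosh (k * (b e + ε e * t - c)) = Real.cosh (k * (b e' + ε e' * t' - c)) := by
      field_simp at h1
      exact h1
    have h5 := le_antisymm (Real.cosh_le_cosh.1 h4.le) (Real.cosh_le_cosh.1 h4.ge)
    rw [abs_mul, abs_mul] at h5
    have h6 := mul_left_cancel₀ (abs_pos.2 hk.ne').ne' h5
    exact abs_eq_abs.1 h6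
  have hfold : G.IsFoldedLine S := by
    refine ⟨σ, ?_, ?_, ?_⟩
    · intro e s _ t _
      have : σ e s - σ e t = ε e * (s - t) := by simp only [hσ]; ring
      rw [this, abs_mul]
      rcases h.sign e (mem_univ e) with h1 | h1 <;> simp [h1]
    · intro x
      obtain ⟨e, -, t, ht, h1⟩ := h.exists_eq (x + c) (mem_univ _)
      exact ⟨e, t, ht, by simp only [hσ]; linarith⟩
    · intro e t ht e' t' ht'
      constructor
      · intro hs
        rcases habs e t ht e' t' ht' hs with h1 | h1
        · exact .inl h1
        · rcases lt_trichotomy (σ e t) 0 with h2 | h2 | h2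
          · refine .inr ⟨h1, ?_⟩
            rw [abs_of_neg h2]
            exact ⟨by linarith, e', t', ht', e, t, ht, hs.symm, by linarith, by linarith⟩
          · exact .inl (by linarith)
          · refine .inr ⟨h1, ?_⟩
            rw [abs_of_pos h2]
            exact ⟨h2, e, t, ht, e', t', ht', hs, rfl, by linarith⟩
      · rintro (h1 | ⟨h1, h2, e₁, t₁, ht₁, e₂, t₂, ht₂, hs, h3, h4⟩)
        · exact hsame e t ht e' t' ht' h1
        · rcases le_total 0 (σ e t) with h5 | h5
          · rw [abs_of_nonneg h5] at h3 h4
            exact ((hsame e t ht e₁ t₁ ht₁ h3.symm).trans hs).trans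
              (hsame e₂ t₂ ht₂ e' t' ht' (by linarith))
          · rw [abs_of_nonpos h5] at h3 h4
            exact ((hsame e t ht e₂ t₂ ht₂ (by linarith)).trans hs.symm).trans
              (hsame e₁ t₁ ht₁ e' t' ht' (by linarith))
  -- Opposite nonzero coordinates are distinct, so points identified there are vertices, and these
  -- have finitely many coordinates.
  have hfin : S.Finite := by
    refine (finite_iUnion fun e : E ⊕ H => (G.finite_setOf_isEnd e).image (σ e)).subset ?_
    rintro s ⟨hs, e, t, -, e', t', -, hsp, h1, h2⟩
    rcases hsp with ⟨rfl, rfl⟩ | ⟨v, hv, -⟩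
    · linarith
    · exact mem_iUnion.2 ⟨e, t, ⟨v, hv⟩, h1⟩
  by_cases hne : S.Nonempty
  · refine .inr ⟨hfin.toFinset, by simpa using hne, ?_, by simpa using hfold⟩
    intro s hs
    exact (hfin.mem_toFinset.1 hs).1
  · rw [not_nonempty_iff_eq_empty] at hne
    rw [hne] at hfold
    exact .inl hfold

theorem H1.eq_zero_of_setIntegral_eq_zero (u : G.H1) (e : E ⊕ H)
    (h : ∫ t in G.interval e, ‖u.toFun e t‖ ^ 2 = 0) : ∀ t ∈ G.interval e, u.toFun e t = 0 := by
  rw [setIntegral_eq_zero_iff_of_nonneg_ae (by filter_upwards with t; simp)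
    (u.integrableOn_sq e)] at h
  have h1 : (fun t => ‖u.toFun e t‖ ^ 2) =ᵐ[volume.restrict (interior (G.interval e))] 0 :=
    ae_restrict_of_ae_restrict_of_subset interior_subset h
  have h2 := Measure.eqOn_open_of_ae_eq h1 isOpen_interior
    (((u.continuousOn e).norm.pow 2).mono interior_subset) continuousOn_const
  have h3 := h2.of_subset_closure ((u.continuousOn e).norm.pow 2) continuousOn_const
    interior_subset (G.interval_subset_closure_interior e)
  intro t ht
  simpa using h3 ht

variable [Fintype E] [Fintype H]

/-- The main estimate: at the critical mass of the line the energy is nonnegative, and it vanishes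
only on the line and on the towers of bubbles. -/
theorem HasCycleCovering.energy_nonneg [Nonempty H] (hH : G.HasCycleCovering)
    (hconn : G.Connected) {u : G.H1} (hm : massScale * G.mass u = Real.pi) :
    0 ≤ G.energy u ∧ (G.energy u = 0 → G.IsRealLine ∨ G.IsTowerOfBubbles) := by
  classical
  choose L ε b hT hc using hH.exists_isTiling hconn
  choose w w' hw hwe hwe' using fun e => (hT e).exists_isH1Line u
  choose x hx using fun e => (hw e).exists_max
  -- Each edge lies on its own line, so the largest of the maxima along these lines bounds |u| on
  -- the whole graph.
  obtain ⟨e₀, -, he₀⟩ := Finset.exists_max_image Finset.univ (fun e => ‖w e (x e)‖ ^ 2)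
    ⟨Sum.inr (Classical.arbitrary H), Finset.mem_univ (α := E ⊕ H) _⟩
  have hmax : ∀ e, ∀ t ∈ G.interval e, ‖u.toFun e t‖ ^ 2 ≤ ‖w e₀ (x e₀)‖ ^ 2 := by
    intro e t ht
    rw [← hwe e e (hc e) t ht]
    exact (hx e _).trans (he₀ e (Finset.mem_univ e))
  generalize x e₀ = x₀ at hmax
  have hT := hT e₀
  have hw := hw e₀
  have hwe := hwe e₀
  have hwe' := hwe' e₀
  generalize w e₀ = w at *
  generalize w' e₀ = w' at *
  generalize hLL : L e₀ = L₀ at *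
  generalize ε e₀ = ε at *
  generalize b e₀ = b at *
  set m : E ⊕ H → ℝ := fun e => ∫ t in G.interval e, ‖u.toFun e t‖ ^ 2 with hmdef
  set T : E ⊕ H → ℝ := fun e => ∫ t in G.interval e, ‖u.weakDeriv e t‖ ^ 2 with hTdef
  set S : E ⊕ H → ℝ := fun e => ∫ t in G.interval e, ‖u.toFun e t‖ ^ 6 with hSdef
  have hm0 : ∀ e, 0 ≤ m e := fun e => integral_nonneg fun _ => by positivity
  have hT0 : ∀ e, 0 ≤ T e := fun e => integral_nonneg fun _ => by positivity
  have hS6 : ∀ e, IntegrableOn (fun t => ‖u.toFun e t‖ ^ 6) (G.interval e) ∧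
      S e ≤ ‖w x₀‖ ^ 4 * m e := by
    intro e
    have hbd : ∀ t ∈ G.interval e, ‖u.toFun e t‖ ^ 6 ≤ ‖w x₀‖ ^ 4 * ‖u.toFun e t‖ ^ 2 := by
      intro t ht
      have h1 := pow_le_pow_left₀ (by positivity) (hmax e t ht) 2
      nlinarith [sq_nonneg ‖u.toFun e t‖]
    have hi := (u.integrableOn_sq e).const_mul (‖w x₀‖ ^ 4)
    have h6 : IntegrableOn (fun t => ‖u.toFun e t‖ ^ 6) (G.interval e) := by
      refine hi.mono' ?_ ?_
      · exact (((u.continuousOn e).norm.pow 6).aestronglyMeasurable (G.measurableSet_interval e))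
      · filter_upwards [ae_restrict_mem (G.measurableSet_interval e)] with t ht
        rw [Real.norm_of_nonneg (by positivity)]
        exact hbd t ht
    refine ⟨h6, ?_⟩
    simp only [hSdef, hmdef]
    rw [← MeasureTheory.integral_const_mul]
    exact setIntegral_mono_on h6 hi (G.measurableSet_interval e) hbd
  have hline_m : ∫ y, ‖w y‖ ^ 2 = ∑ e with e ∈ L₀, m e := by
    rw [hT.integral_eq hw.integrable_sq]
    refine Finset.sum_congr rfl fun e he => setIntegral_congr_fun (G.measurableSet_interval e) ?_
    intro t ht
    simp only [hwe e (Finset.mem_filter.1 he).2 t ht]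
  have hline_E : ∫ y, energyDensity w w' y = ∑ e with e ∈ L₀, (1 / 2 * T e - 1 / 6 * S e) := by
    rw [hT.integral_eq hw.integrable_energyDensity]
    refine Finset.sum_congr rfl fun e he => ?_
    have he := (Finset.mem_filter.1 he).2
    simp only [hTdef, hSdef]
    rw [← MeasureTheory.integral_const_mul, ← MeasureTheory.integral_const_mul, ← MeasureTheory.integral_sub
      ((u.integrableOn_weakDeriv_sq e).const_mul _) ((hS6 e).1.const_mul _)]
    refine MeasureTheory.integral_congr_ae ?_
    filter_upwards [hwe' e he, ae_restrict_mem (G.measurableSet_interval e)] with t ht htI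
    rw [energyDensity, ht, hwe e he t htI, norm_mul]
    rcases hT.sign e he with h1 | h1 <;> simp [h1]
  have hEsum : G.energy u = (∑ e with e ∈ L₀, (1 / 2 * T e - 1 / 6 * S e)) +
      ∑ e with e ∉ L₀, (1 / 2 * T e - 1 / 6 * S e) := by
    rw [Finset.sum_filter_add_sum_filter_not, Finset.sum_sub_distrib, ← Finset.mul_sum,
      ← Finset.mul_sum]
    rfl
  have hmsum : G.mass u = (∑ e with e ∈ L₀, m e) + ∑ e with e ∉ L₀, m e := by
    rw [Finset.sum_filter_add_sum_filter_not]; rfl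
  set m' := ∑ e with e ∉ L₀, m e with hm'
  have hm'0 : 0 ≤ m' := Finset.sum_nonneg fun e _ => hm0 e
  -- Off the line the kinetic energy is discarded and |u|⁶ is bounded by M⁴|u|², with M the maximum
  -- on the line.
  have hoff : -(‖w x₀‖ ^ 4 * m' / 6) ≤ ∑ e with e ∉ L₀, (1 / 2 * T e - 1 / 6 * S e) := by
    have : -(‖w x₀‖ ^ 4 * m' / 6) = ∑ e with e ∉ L₀, -(1 / 6 * (‖w x₀‖ ^ 4 * m e)) := by
      rw [hm', Finset.sum_neg_distrib, ← Finset.mul_sum, ← Finset.mul_sum]; ring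
    rw [this]
    refine Finset.sum_le_sum fun e _ => ?_
    linarith [(hS6 e).2, hT0 e]
  have hpos : 0 < ‖w x₀‖ ^ 2 := by
    by_contra hcon
    have hz : ∀ e, m e = 0 := by
      intro e
      refine setIntegral_eq_zero_of_forall_eq_zero fun t ht => ?_
      exact le_antisymm ((hmax e t ht).trans (not_lt.1 hcon)) (by positivity)
    have : G.mass u = 0 := Finset.sum_eq_zero fun e _ => hz e
    rw [this, mul_zero] at hm
    exact Real.pi_ne_zero hm.symm
  have htot : massScale * ((∫ y, ‖w y‖ ^ 2) + m') = Real.pi := by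
    rw [hline_m, ← hmsum, hm]
  obtain ⟨hle, hrig⟩ := hw.le_integral_energyDensity hpos hm'0 htot
  refine ⟨by rw [hEsum, ← hline_E]; linarith, fun hE0 => ?_⟩
  obtain ⟨hm'z, -, -⟩ := hrig (by rw [hEsum, ← hline_E] at hE0; linarith)
  rw [hm'z] at htot hoff hle
  obtain ⟨C, k, c, hC, hk, hsech⟩ := hw.exists_sech hpos (by simpa using htot)
    (by rw [hEsum, ← hline_E] at hE0; linarith)
  have honline : ∀ e ∈ L₀, ∀ t ∈ G.interval e, u.toFun e t ≠ 0 := by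
    intro e he t ht h0
    have h1 := hsech (b e + ε e * t)
    rw [hwe e he t ht, h0] at h1
    have h2 : 0 < C / Real.cosh (k * (b e + ε e * t - c)) := div_pos hC (Real.cosh_pos _)
    simp at h1
    linarith
  have hoffline : ∀ e, e ∉ L₀ → ∀ t ∈ G.interval e, u.toFun e t = 0 := by
    intro e he
    refine u.eq_zero_of_setIntegral_eq_zero e ?_
    exact (Finset.sum_eq_zero_iff_of_nonneg fun e _ => hm0 e).1 (hm'.symm.trans hm'z) e (by simpa using he)
  obtain ⟨val, hval⟩ := u.continuous_vertex
  have hvalL : ∀ e t v, G.IsEnd e t v → (val v ≠ 0 ↔ e ∈ L₀) := by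
    intro e t v hend
    rw [← hval e t v hend]
    by_cases he : e ∈ L₀
    · simp [he, honline e he t hend.mem_interval]
    · simp [he, hoffline e he t hend.mem_interval]
  -- A bounded edge on the line has nonzero values at both ends, and one off the line has zero
  -- values at both; connectedness spreads the alternative to all vertices, so no edge is left out.
  have hconst : ∀ v v', val v ≠ 0 ↔ val v' ≠ 0 := by
    intro v v'
    induction hconn v v' with
    | rel a d h =>
      obtain ⟨e, rfl, rfl⟩ := h
      rw [hvalL (.inl e) 0 _ (.inl ⟨rfl, rfl⟩), hvalL (.inl e) (G.len e) _ (.inr ⟨rfl, rfl⟩)]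
    | refl => rfl
    | symm _ _ _ ih => exact ih.symm
    | trans _ _ _ _ _ ih ih' => exact ih.trans ih'
  have hall : L₀ = univ := by
    refine eq_univ_of_forall fun e => ?_
    obtain ⟨v, hv⟩ := G.exists_isEnd_zero e
    obtain ⟨v', hv'⟩ := G.exists_isEnd_zero e₀
    exact (hvalL e 0 v hv).1 ((hconst v v').2 ((hvalL e₀ 0 v' hv').2 (hLL ▸ hc e₀)))
  rw [hall] at hT
  refine hT.isFoldedLine (u := u) (c := c) hC hk fun e t ht => ?_
  rw [← hwe e (hall ▸ mem_univ e) t ht]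
  exact hsech _

end MetricGraph

/-! ### The hyperbolic secant and its square root -/

/-- The square root of the hyperbolic secant, a soliton of the critical equation on the line. -/
def sqrtSech (x : ℝ) : ℝ := (√(Real.cosh x))⁻¹

/-- The derivative of `sqrtSech`. -/
def sqrtSechDeriv (x : ℝ) : ℝ := -(1 / 2) * Real.tanh x * sqrtSech x

theorem sqrtSech_neg (x : ℝ) : sqrtSech (-x) = sqrtSech x := by
  rw [sqrtSech, Real.cosh_neg, sqrtSech]

theorem sqrtSech_sq (x : ℝ) : sqrtSech x ^ 2 = (Real.cosh x)⁻¹ := by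
  rw [sqrtSech, inv_pow, Real.sq_sqrt (Real.cosh_pos x).le]

theorem sqrtSech_pow_six (x : ℝ) : sqrtSech x ^ 6 = (Real.cosh x)⁻¹ ^ 3 := by
  rw [← sqrtSech_sq]; ring

theorem sqrtSechDeriv_sq (x : ℝ) :
    sqrtSechDeriv x ^ 2 = 1 / 4 * ((Real.cosh x)⁻¹ - (Real.cosh x)⁻¹ ^ 3) := by
  have h := (Real.cosh_pos x).ne'
  rw [sqrtSechDeriv, mul_pow, sqrtSech_sq, Real.tanh_eq_sinh_div_cosh, mul_pow, div_pow,
    Real.sinh_sq]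
  field_simp
  ring

theorem hasDerivAt_sqrtSech (x : ℝ) : HasDerivAt sqrtSech (sqrtSechDeriv x) x := by
  have h := Real.cosh_pos x
  have h1 := ((Real.hasDerivAt_cosh x).sqrt h.ne').inv (Real.sqrt_pos.2 h).ne'
  convert! h1 using 1
  rw [sqrtSechDeriv, sqrtSech, Real.tanh_eq_sinh_div_cosh]
  have h2 := Real.sq_sqrt h.le
  have h3 := (Real.sqrt_pos.2 h).ne'
  field_simp
  rw [h2]

theorem continuous_sqrtSech : Continuous sqrtSech :=
  continuous_iff_continuousAt.2 fun x => (hasDerivAt_sqrtSech x).continuousAt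

theorem continuous_sqrtSechDeriv : Continuous sqrtSechDeriv := by
  have h1 : Continuous Real.tanh := by
    simp only [funext Real.tanh_eq_sinh_div_cosh]
    exact Real.continuous_sinh.div Real.continuous_cosh fun x => (Real.cosh_pos x).ne'
  have := continuous_sqrtSech
  unfold sqrtSechDeriv
  fun_prop

theorem hasDerivAt_arctan_sinh (x : ℝ) :
    HasDerivAt (fun x => Real.arctan (Real.sinh x)) (Real.cosh x)⁻¹ x := by
  convert! (Real.hasDerivAt_sinh x).arctan using 1
  have := (Real.cosh_pos x).ne'
  rw [add_comm, ← Real.cosh_sq]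
  field_simp

theorem tendsto_sinh_atTop : Tendsto Real.sinh atTop atTop :=
  tendsto_atTop_mono' _ ((eventually_ge_atTop 0).mono fun _ h => Real.self_le_sinh_iff.2 h)
    tendsto_id

theorem tendsto_sinh_atBot : Tendsto Real.sinh atBot atBot := by
  have := tendsto_neg_atTop_atBot.comp (tendsto_sinh_atTop.comp tendsto_neg_atBot_atTop)
  simpa [Function.comp_def] using this

theorem tendsto_arctan_sinh_atTop :
    Tendsto (fun x => Real.arctan (Real.sinh x)) atTop (𝓝 (Real.pi / 2)) :=
  (tendsto_nhds_of_tendsto_nhdsWithin Real.tendsto_arctan_atTop).comp tendsto_sinh_atTop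

theorem tendsto_arctan_sinh_atBot :
    Tendsto (fun x => Real.arctan (Real.sinh x)) atBot (𝓝 (-(Real.pi / 2))) :=
  (tendsto_nhds_of_tendsto_nhdsWithin Real.tendsto_arctan_atBot).comp tendsto_sinh_atBot

theorem continuous_sech : Continuous fun x => (Real.cosh x)⁻¹ :=
  Real.continuous_cosh.inv₀ fun x => (Real.cosh_pos x).ne'

theorem sech_pos (x : ℝ) : 0 < (Real.cosh x)⁻¹ := inv_pos.2 (Real.cosh_pos x)

theorem sech_le_one (x : ℝ) : (Real.cosh x)⁻¹ ≤ 1 := inv_le_one_of_one_le₀ (Real.one_le_cosh x)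

theorem integrable_sech : Integrable fun x => (Real.cosh x)⁻¹ := by
  have h0 : IntegrableOn (fun x => (Real.cosh x)⁻¹) (Ioi 0) :=
    integrableOn_Ioi_deriv_of_nonneg' (fun x _ => hasDerivAt_arctan_sinh x)
      (fun x _ => (sech_pos x).le) tendsto_arctan_sinh_atTop
  have h1 : IntegrableOn (fun x => (Real.cosh x)⁻¹) (Iic 0) := by
    rw [← integrableOn_Ici_iff_integrableOn_Ioi] at h0
    simpa using h0.comp_neg
  rw [← integrableOn_univ, ← Iic_union_Ioi]
  exact h1.union h0

theorem integral_sech : ∫ x, (Real.cosh x)⁻¹ = Real.pi := by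
  rw [integral_of_hasDerivAt_of_tendsto hasDerivAt_arctan_sinh integrable_sech
    tendsto_arctan_sinh_atBot tendsto_arctan_sinh_atTop]
  ring

theorem integrable_sech_pow_three : Integrable fun x => (Real.cosh x)⁻¹ ^ 3 := by
  refine integrable_sech.mono' (continuous_sech.pow 3).aestronglyMeasurable ?_
  filter_upwards with x
  have h := (sech_pos x).le
  rw [Real.norm_of_nonneg (by positivity)]
  exact pow_le_of_le_one h (sech_le_one x) (by norm_num)

theorem integral_sech_pow_three : ∫ x, (Real.cosh x)⁻¹ ^ 3 = Real.pi / 2 := by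
  have hd : ∀ x, HasDerivAt (fun x => 1 / 2 * (Real.tanh x * (Real.cosh x)⁻¹ +
      Real.arctan (Real.sinh x))) ((Real.cosh x)⁻¹ ^ 3) x := by
    intro x
    have h := (Real.cosh_pos x).ne'
    simp only [Real.tanh_eq_sinh_div_cosh]
    have h1 := ((Real.hasDerivAt_sinh x).div (Real.hasDerivAt_cosh x) h).mul
      ((Real.hasDerivAt_cosh x).inv h)
    convert! (h1.add (hasDerivAt_arctan_sinh x)).const_mul (1 / 2) using 1
    have := Real.cosh_sq x
    simp only [Pi.div_apply, Pi.inv_apply]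
    field_simp
    simp only [Real.sinh_sq]
    ring
  have hlim : ∀ l : Filter ℝ, Tendsto (fun x => |Real.sinh x|) l atTop →
      Tendsto (fun x => Real.tanh x * (Real.cosh x)⁻¹) l (𝓝 0) := by
    intro l hl
    have h1 : Tendsto (fun x => (Real.cosh x)⁻¹) l (𝓝 0) := by
      refine (tendsto_atTop_mono (fun x => ?_) hl).inv_tendsto_atTop
      refine abs_le_of_sq_le_sq ?_ (Real.cosh_pos x).le
      rw [Real.sinh_sq]
      linarith
    refine squeeze_zero_norm (fun x => ?_) h1
    rw [norm_mul, Real.norm_of_nonneg (sech_pos x).le]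
    exact mul_le_of_le_one_left (sech_pos x).le (Real.abs_tanh_lt_one x).le
  rw [integral_of_hasDerivAt_of_tendsto hd integrable_sech_pow_three
    (((hlim _ (tendsto_abs_atBot_atTop.comp tendsto_sinh_atBot)).add
      tendsto_arctan_sinh_atBot).const_mul _)
    (((hlim _ (tendsto_abs_atTop_atTop.comp tendsto_sinh_atTop)).add
      tendsto_arctan_sinh_atTop).const_mul _)]
  ring

theorem integral_sqrtSech_sq : ∫ x, sqrtSech x ^ 2 = Real.pi := by
  simp only [sqrtSech_sq, integral_sech]

theorem integral_sqrtSech_pow_six : ∫ x, sqrtSech x ^ 6 = Real.pi / 2 := by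
  simp only [sqrtSech_pow_six, integral_sech_pow_three]

theorem integral_sqrtSechDeriv_sq : ∫ x, sqrtSechDeriv x ^ 2 = Real.pi / 8 := by
  simp only [sqrtSechDeriv_sq]
  rw [MeasureTheory.integral_const_mul, MeasureTheory.integral_sub integrable_sech
    integrable_sech_pow_three, integral_sech, integral_sech_pow_three]
  ring

theorem integrable_sqrtSech_sq : Integrable fun x => sqrtSech x ^ 2 := by
  simpa only [sqrtSech_sq] using integrable_sech

theorem integrable_sqrtSech_pow_six : Integrable fun x => sqrtSech x ^ 6 := by
  simpa only [sqrtSech_pow_six] using integrable_sech_pow_three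

theorem integrable_sqrtSechDeriv_sq : Integrable fun x => sqrtSechDeriv x ^ 2 := by
  simp only [sqrtSechDeriv_sq]
  exact (integrable_sech.sub integrable_sech_pow_three).const_mul _

/-- An isometry of an interval `I` starting at `0` into the line is affine. -/
theorem exists_eq_add_mul_of_isometry {I : Set ℝ} {σ : ℝ → ℝ} (h0 : 0 ∈ I)
    (hI : ∃ p ∈ I, 0 < p) (h : ∀ s ∈ I, ∀ t ∈ I, |σ s - σ t| = |s - t|) :
    ∃ ε : ℝ, (ε = 1 ∨ ε = -1) ∧ ∀ t ∈ I, σ t = σ 0 + ε * t := by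
  obtain ⟨p, hp, hp0⟩ := hI
  have key : ∀ ε : ℝ, (ε = 1 ∨ ε = -1) → σ p = σ 0 + ε * p → ∀ t ∈ I, σ t = σ 0 + ε * t := by
    intro ε hε h1 t ht
    have hε2 : ε ^ 2 = 1 := by rcases hε with rfl | rfl <;> norm_num
    have h2 := sq_eq_sq_iff_abs_eq_abs _ _ |>.2 (h t ht 0 h0)
    have h3 := sq_eq_sq_iff_abs_eq_abs _ _ |>.2 (h t ht p hp)
    rw [h1] at h3
    -- Subtracting the squared distances of σ t to σ 0 and to σ p leaves an identity linear in σ t,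
    -- from which p cancels.
    have h4 : (σ t - σ 0) * ε = t := mul_right_cancel₀ hp0.ne' (by linear_combination (h2 - h3) / 2 + p ^ 2 / 2 * hε2)
    linear_combination ε * h4 - (σ t - σ 0) * hε2
  have h1 := h p hp 0 h0
  rw [sub_zero, abs_eq_abs] at h1
  rcases h1 with h1 | h1
  · exact ⟨1, .inl rfl, key 1 (.inl rfl) (by linarith)⟩
  · exact ⟨-1, .inr rfl, key (-1) (.inr rfl) (by linarith)⟩

/-! ### The soliton on a folded line -/

namespace MetricGraph

variable {V E H : Type*} {G : MetricGraph V E H}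

/-- The element of `H¹(𝒢)` given by a family of continuously differentiable functions. -/
def H1.ofHasDerivAt (f f' : E ⊕ H → ℝ → ℂ) (hf : ∀ e x, HasDerivAt (f e) (f' e x) x)
    (hf' : ∀ e, Continuous (f' e))
    (hv : ∀ v e t e' t', G.IsEnd e t v → G.IsEnd e' t' v → f e t = f e' t')
    (hi : ∀ e, IntegrableOn (fun t => ‖f e t‖ ^ 2) (G.interval e))
    (hi' : ∀ e, IntegrableOn (fun t => ‖f' e t‖ ^ 2) (G.interval e)) : G.H1 where
  toFun := f
  weakDeriv := f'
  continuousOn e := (continuous_iff_continuousAt.2 fun x => (hf e x).continuousAt).continuousOn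
  continuous_vertex := by
    classical
    refine ⟨fun v => if h : ∃ p : (E ⊕ H) × ℝ, G.IsEnd p.1 p.2 v then f h.choose.1 h.choose.2
      else 0, fun e t v hv' => ?_⟩
    have h : ∃ p : (E ⊕ H) × ℝ, G.IsEnd p.1 p.2 v := ⟨(e, t), hv'⟩
    simp only [dif_pos h]
    exact hv v _ _ _ _ hv' h.choose_spec
  memLp e := (memLp_two_iff_integrable_sq_norm (continuous_iff_continuousAt.2
    fun x => (hf e x).continuousAt).aestronglyMeasurable).2 (hi e)
  memLp_weakDeriv e := (memLp_two_iff_integrable_sq_norm (hf' e).aestronglyMeasurable).2 (hi' e)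
  hasWeakDerivOn e := hasWeakDerivOn_of_hasDerivAt (hf e) (hf' e) _

theorem exists_pos_mem_interval (e : E ⊕ H) : ∃ p ∈ G.interval e, 0 < p := by
  cases e with
  | inl e => exact ⟨G.len e, ⟨(G.len_pos e).le, le_rfl⟩, G.len_pos e⟩
  | inr h => exact ⟨1, mem_Ici.2 zero_le_one, one_pos⟩

variable [Fintype E] [Fintype H]

/-- A folded line carries the soliton. -/
theorem IsFoldedLine.exists_energy_eq_zero {S : Set ℝ} (h : G.IsFoldedLine S) :
    ∃ u : G.H1, G.mass u = Real.pi * √3 / 2 ∧ G.energy u = 0 := by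
  obtain ⟨σ, hiso, hsurj, hsame⟩ := h
  choose ε hε hσ using fun e =>
    exists_eq_add_mul_of_isometry (G.zero_mem_interval e) (exists_pos_mem_interval e) (hiso e)
  set b : E ⊕ H → ℝ := fun e => σ e 0
  have hT : G.IsTiling univ ε b univ :=
    { sign := fun e _ => hε e
      mem := fun _ _ _ _ => mem_univ _
      exists_eq := fun x _ => by
        obtain ⟨e, t, ht, rfl⟩ := hsurj x
        exact ⟨e, mem_univ e, t, ht, (hσ e t ht).symm⟩
      samePoint := fun e _ t ht e' _ t' ht' heq =>
        (hsame e t ht e' t' ht').2 (.inl (by rw [hσ e t ht, hσ e' t' ht', heq])) }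
  have hsum : ∀ {F : ℝ → ℝ}, Integrable F →
      ∑ e, ∫ t in G.interval e, F (b e + ε e * t) = ∫ x, F x := fun hF => by
    simp only [hT.integral_eq hF, mem_univ, Finset.filter_true]
  -- The square of the amplitude: it gives mass π√3/2, and C² = 3/4 balances Cπ/16 against C³π/12 in
  -- the energy.
  set C : ℝ := √3 / 2
  have hC : 0 ≤ C := by positivity
  have hε2 : ∀ e, ‖ε e‖ = 1 := fun e => by rcases hε e with h | h <;> simp [h]
  set c : ℝ := √C
  have hc2 : c ^ 2 = C := Real.sq_sqrt hC
  have n2 : ∀ x : ℝ, ‖((c * sqrtSech x : ℝ) : ℂ)‖ ^ 2 = C * sqrtSech x ^ 2 := fun x => by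
    rw [Complex.norm_real, Real.norm_eq_abs, sq_abs, mul_pow, hc2]
  have n6 : ∀ x : ℝ, ‖((c * sqrtSech x : ℝ) : ℂ)‖ ^ 6 = C ^ 3 * sqrtSech x ^ 6 := fun x => by
    rw [show 6 = 2 * 3 from rfl, pow_mul, n2, mul_pow, ← pow_mul]
  have n2' : ∀ e, ∀ x : ℝ, ‖((c * (sqrtSechDeriv x * ε e) : ℝ) : ℂ)‖ ^ 2 =
      C * sqrtSechDeriv x ^ 2 := fun e x => by
    rw [Complex.norm_real, ← mul_assoc, norm_mul, hε2, mul_one, Real.norm_eq_abs, sq_abs, mul_pow,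
      hc2]
  have hcs := continuous_sqrtSechDeriv
  have i2 := integrable_sqrtSech_sq.const_mul C
  have i2' := integrable_sqrtSechDeriv_sq.const_mul C
  refine ⟨H1.ofHasDerivAt (fun e t => ((c * sqrtSech (b e + ε e * t) : ℝ) : ℂ))
    (fun e t => ((c * (sqrtSechDeriv (b e + ε e * t) * ε e) : ℝ) : ℂ)) ?_ ?_ ?_ ?_ ?_, ?_, ?_⟩
  · intro e x
    have h1 := (hasDerivAt_sqrtSech (b e + ε e * x)).comp x
      (((hasDerivAt_id x).const_mul (ε e)).const_add (b e))
    rw [mul_one] at h1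
    exact (h1.const_mul c).ofReal_comp
  · intro e
    fun_prop
  · intro v e t e' t' he he'
    have h1 := (hsame e t he.mem_interval e' t' he'.mem_interval).1 (.inr ⟨v, he, he'⟩)
    rw [hσ e t he.mem_interval, hσ e' t' he'.mem_interval] at h1
    rcases h1 with h1 | ⟨h1, -⟩
    · simp only [b, h1]
    -- Evenness of the soliton makes it single-valued where x and -x are glued.
    · simp only [b, h1, sqrtSech_neg]
  · intro e
    simp only [n2]
    exact hT.integrable_iff.1 i2 e (mem_univ e)
  · intro e
    simp only [n2']
    exact hT.integrable_iff.1 i2' e (mem_univ e)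
  · simp only [mass, integral, H1.ofHasDerivAt, n2]
    rw [hsum i2, MeasureTheory.integral_const_mul, integral_sqrtSech_sq]
    ring
  · simp only [energy, kinetic, sextic, integral, H1.ofHasDerivAt, n2', n6]
    rw [hsum i2', hsum (integrable_sqrtSech_pow_six.const_mul _), MeasureTheory.integral_const_mul,
      MeasureTheory.integral_const_mul, integral_sqrtSech_pow_six, integral_sqrtSechDeriv_sq]
    have hC2 : C ^ 2 = 3 / 4 := by rw [div_pow, Real.sq_sqrt (by norm_num)]; norm_num
    linear_combination -(C * Real.pi / 12) * hC2

end MetricGraph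

/-! ### Solitons escaping along a halfline -/

/-- The first argument of F stands for the cutoff exp(-t), the second for the coordinate centred at
R. After translation by R the cutoff tends to 0 pointwise and the endpoint recedes to -∞; the
hyperbolic secant dominates. -/
theorem tendsto_integral_Ici_comp_sub {F : ℝ → ℝ → ℝ} (hF : Continuous fun p : ℝ × ℝ => F p.1 p.2)
    (hb : ∀ y ∈ Icc (0 : ℝ) 1, ∀ x, |F y x| ≤ (Real.cosh x)⁻¹) :
    (∀ R, IntegrableOn (fun t => F (Real.exp (-t)) (t - R)) (Ici 0)) ∧
      Tendsto (fun R => ∫ t in Ici 0, F (Real.exp (-t)) (t - R)) atTop (𝓝 (∫ x, F 0 x)) := by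
  have hc : ∀ R, Continuous fun t => F (Real.exp (-t)) (t - R) := fun R =>
    hF.comp (by fun_prop : Continuous fun t => (Real.exp (-t), t - R))
  have hexp : ∀ t : ℝ, 0 ≤ t → Real.exp (-t) ∈ Icc (0 : ℝ) 1 := fun t ht =>
    ⟨(Real.exp_pos _).le, Real.exp_le_one_iff.2 (by linarith)⟩
  constructor
  · intro R
    refine (integrable_sech.comp_sub_right R).integrableOn.mono' (hc R).aestronglyMeasurable ?_
    filter_upwards [ae_restrict_mem measurableSet_Ici] with t ht
    exact hb _ (hexp t ht) _
  · have h1 : ∀ R, ∫ t in Ici 0, F (Real.exp (-t)) (t - R) =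
        ∫ x, (Ici (-R)).indicator (fun x => F (Real.exp (-(x + R))) x) x := by
      intro R
      rw [← MeasureTheory.integral_indicator measurableSet_Ici,
        ← integral_add_right_eq_self (μ := volume) _ R]
      refine integral_congr_ae ?_
      filter_upwards with x
      by_cases hx : -R ≤ x
      · rw [indicator_of_mem (show x + R ∈ Ici 0 by rw [mem_Ici]; linarith),
          indicator_of_mem (mem_Ici.2 hx), add_sub_cancel_right]
      · rw [indicator_of_notMem (show x + R ∉ Ici 0 by rw [mem_Ici]; intro h; apply hx; linarith),
          indicator_of_notMem (by rwa [mem_Ici])]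
    simp only [h1]
    refine tendsto_integral_filter_of_dominated_convergence (fun x => (Real.cosh x)⁻¹) ?_ ?_
      integrable_sech ?_
    · filter_upwards with R
      refine AEStronglyMeasurable.indicator (Continuous.aestronglyMeasurable ?_) measurableSet_Ici
      exact hF.comp (by fun_prop : Continuous fun t => (Real.exp (-(t + R)), t))
    · filter_upwards with R
      filter_upwards with x
      by_cases hx : -R ≤ x
      · rw [indicator_of_mem (mem_Ici.2 hx)]
        exact hb _ (hexp _ (by linarith)) _
      · rw [indicator_of_notMem (by rwa [mem_Ici]), norm_zero]
        exact (sech_pos x).le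
    · filter_upwards with x
      have h2 : Tendsto (fun R => F (Real.exp (-(x + R))) x) atTop (𝓝 (F 0 x)) := by
        have h3 : Tendsto (fun R => Real.exp (-(x + R))) atTop (𝓝 0) :=
          Real.tendsto_exp_neg_atTop_nhds_zero.comp (tendsto_atTop_add_const_left _ x tendsto_id)
        exact ((hF.comp (by fun_prop : Continuous fun y => (y, x))).tendsto 0).comp h3
      refine h2.congr' ?_
      filter_upwards [eventually_ge_atTop (-x)] with R hR
      rw [indicator_of_mem (show x ∈ Ici (-R) by rw [mem_Ici]; linarith)]

/-- The soliton centred at `R`, cut off near `0`. -/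
def cutSoliton (R t : ℝ) : ℝ := (1 - Real.exp (-t)) * sqrtSech (t - R)

/-- The derivative of `cutSoliton`. -/
def cutSolitonDeriv (R t : ℝ) : ℝ :=
  Real.exp (-t) * sqrtSech (t - R) + (1 - Real.exp (-t)) * sqrtSechDeriv (t - R)

theorem hasDerivAt_cutSoliton (R t : ℝ) : HasDerivAt (cutSoliton R) (cutSolitonDeriv R t) t := by
  have h1 := (hasDerivAt_sqrtSech (t - R)).comp t ((hasDerivAt_id t).sub_const R)
  have h2 := ((hasDerivAt_neg t).exp.const_sub 1).mul h1
  convert! h2 using 1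
  simp [cutSolitonDeriv]

theorem continuous_cutSolitonDeriv (R : ℝ) : Continuous (cutSolitonDeriv R) := by
  have h1 := continuous_sqrtSech
  have h2 := continuous_sqrtSechDeriv
  unfold cutSolitonDeriv
  fun_prop

theorem sqrtSech_pos (x : ℝ) : 0 < sqrtSech x := inv_pos.2 (Real.sqrt_pos.2 (Real.cosh_pos x))

theorem abs_sqrtSechDeriv_le (x : ℝ) : |sqrtSechDeriv x| ≤ sqrtSech x := by
  rw [sqrtSechDeriv, abs_mul, abs_mul, abs_of_pos (sqrtSech_pos x)]
  refine mul_le_of_le_one_left (sqrtSech_pos x).le ?_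
  have := (Real.abs_tanh_lt_one x).le
  norm_num
  linarith

theorem abs_cutoff_mul_le {y : ℝ} (hy : y ∈ Icc (0 : ℝ) 1) (x : ℝ) :
    |(1 - y) * sqrtSech x| ≤ sqrtSech x := by
  have := sqrtSech_pos x
  rw [abs_mul, abs_of_pos this, abs_of_nonneg (by linarith [hy.2])]
  exact mul_le_of_le_one_left this.le (by linarith [hy.1])

theorem tendsto_cutSoliton_sq : (∀ R, IntegrableOn (fun t => cutSoliton R t ^ 2) (Ici 0)) ∧
    Tendsto (fun R => ∫ t in Ici 0, cutSoliton R t ^ 2) atTop (𝓝 Real.pi) := by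
  have hs := continuous_sqrtSech
  have := tendsto_integral_Ici_comp_sub (F := fun y x => ((1 - y) * sqrtSech x) ^ 2)
    (by fun_prop) ?_
  · simpa [cutSoliton, ← integral_sqrtSech_sq] using this
  · intro y hy x
    rw [abs_pow, ← sqrtSech_sq]
    exact pow_le_pow_left₀ (abs_nonneg _) (abs_cutoff_mul_le hy x) 2

theorem tendsto_cutSoliton_pow_six :
    Tendsto (fun R => ∫ t in Ici 0, cutSoliton R t ^ 6) atTop (𝓝 (Real.pi / 2)) := by
  have hs := continuous_sqrtSech
  have := (tendsto_integral_Ici_comp_sub (F := fun y x => ((1 - y) * sqrtSech x) ^ 6)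
    (by fun_prop) ?_).2
  · simpa [cutSoliton, ← integral_sqrtSech_pow_six] using this
  · intro y hy x
    rw [abs_pow]
    refine (pow_le_pow_left₀ (abs_nonneg _) (abs_cutoff_mul_le hy x) 6).trans ?_
    rw [sqrtSech_pow_six]
    exact pow_le_of_le_one (sech_pos x).le (sech_le_one x) (by norm_num)

theorem tendsto_cutSolitonDeriv_sq :
    (∀ R, IntegrableOn (fun t => cutSolitonDeriv R t ^ 2) (Ici 0)) ∧
      Tendsto (fun R => ∫ t in Ici 0, cutSolitonDeriv R t ^ 2) atTop (𝓝 (Real.pi / 8)) := by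
  have hs := continuous_sqrtSech
  have hs' := continuous_sqrtSechDeriv
  have := tendsto_integral_Ici_comp_sub
    (F := fun y x => (y * sqrtSech x + (1 - y) * sqrtSechDeriv x) ^ 2) (by fun_prop) ?_
  · simpa [cutSolitonDeriv, ← integral_sqrtSechDeriv_sq] using this
  · intro y hy x
    rw [abs_pow, ← sqrtSech_sq]
    refine pow_le_pow_left₀ (abs_nonneg _) ?_ 2
    have h1 := abs_le.1 (abs_sqrtSechDeriv_le x)
    rw [abs_le]
    constructor
    · nlinarith [hy.1, hy.2, sqrtSech_pos x]
    · nlinarith [hy.1, hy.2, sqrtSech_pos x]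

namespace MetricGraph

variable {V E H : Type*} {G : MetricGraph V E H} [Fintype E] [Fintype H]

/-- A function on a halfline vanishing at its endpoint extends by zero to the graph. -/
theorem H1.exists_halfline (h : H) {f f' : ℝ → ℝ} (hf : ∀ x, HasDerivAt f (f' x) x)
    (hf' : Continuous f') (h0 : f 0 = 0) (hi : IntegrableOn (fun t => f t ^ 2) (Ici 0))
    (hi' : IntegrableOn (fun t => f' t ^ 2) (Ici 0)) :
    ∃ u : G.H1, G.mass u = ∫ t in Ici 0, f t ^ 2 ∧ G.kinetic u = ∫ t in Ici 0, f' t ^ 2 ∧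
      G.sextic u = ∫ t in Ici 0, f t ^ 6 := by
  classical
  set s : E ⊕ H → ℝ := Pi.single (.inr h) 1 with hs
  have hs1 : s (.inr h) = 1 := Pi.single_eq_same _ _
  have hs0 : ∀ e ≠ .inr h, s e = 0 := fun e he => Pi.single_eq_of_ne he _
  have hint : ∀ g : ℝ → ℝ, IntegrableOn (fun t => g t ^ 2) (Ici 0) → ∀ e,
      IntegrableOn (fun t => ‖((s e * g t : ℝ) : ℂ)‖ ^ 2) (G.interval e) := by
    intro g hg e
    simp only [Complex.norm_real, Real.norm_eq_abs, sq_abs]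
    by_cases he : e = .inr h
    · subst he
      simpa [hs1, interval] using hg
    · simp [hs0 e he]
  have hsum : ∀ (g : ℝ → ℝ) (n : ℕ), n ≠ 0 → Even n →
      ∑ e, ∫ t in G.interval e, ‖((s e * g t : ℝ) : ℂ)‖ ^ n = ∫ t in Ici 0, g t ^ n := by
    intro g n hn hn'
    simp only [Complex.norm_real, Real.norm_eq_abs, hn'.pow_abs]
    rw [Finset.sum_eq_single (.inr h)]
    · simp [hs1, interval]
    · intro e _ he
      simp [hs0 e he, hn]
    · simp
  have hend : ∀ e t v, G.IsEnd e t v → s e * f t = 0 := by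
    intro e t v he
    by_cases h' : e = .inr h
    · subst h'
      rw [he.1, h0, mul_zero]
    · rw [hs0 e h', zero_mul]
  refine ⟨H1.ofHasDerivAt (fun e t => ((s e * f t : ℝ) : ℂ)) (fun e t => ((s e * f' t : ℝ) : ℂ))
    (fun e x => ((hf x).const_mul (s e)).ofReal_comp) (fun e => by fun_prop)
    (fun v e t e' t' he he' => by rw [hend e t v he, hend e' t' v he']) (hint f hi) (hint f' hi'),
    ?_, ?_, ?_⟩
  · exact hsum f 2 two_ne_zero even_two
  · exact hsum f' 2 two_ne_zero even_two
  · exact hsum f 6 (by norm_num) (by decide)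

/-- Solitons escaping along a halfline have the Gagliardo-Nirenberg quotient of the line in the
limit. -/
theorem exists_tendsto_quotient (h : H) : ∃ u : ℝ → G.H1, (∀ᶠ R in atTop, G.mass (u R) ≠ 0) ∧
    Tendsto (fun R => G.sextic (u R) / (G.mass (u R) ^ 2 * G.kinetic (u R))) atTop
      (𝓝 (4 / Real.pi ^ 2)) := by
  choose u h2 h2' h6 using fun R => H1.exists_halfline (G := G) h (hasDerivAt_cutSoliton R)
    (continuous_cutSolitonDeriv R) (by simp [cutSoliton]) (tendsto_cutSoliton_sq.1 R)
    (tendsto_cutSolitonDeriv_sq.1 R)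
  have hpi := Real.pi_ne_zero
  refine ⟨u, ?_, ?_⟩
  · simp only [h2]
    exact tendsto_cutSoliton_sq.2.eventually_ne hpi
  · simp only [h2, h2', h6]
    have := tendsto_cutSoliton_pow_six.div ((tendsto_cutSoliton_sq.2.pow 2).mul
      tendsto_cutSolitonDeriv_sq.2) (by positivity)
    have hlim : 4 / Real.pi ^ 2 = Real.pi / 2 / (Real.pi ^ 2 * (Real.pi / 8)) := by
      field_simp
      norm_num
    rw [hlim]
    exact this

/-- Spreading a function along a halfline makes the kinetic energy vanish at fixed mass. -/
theorem exists_tendsto_kinetic (h : H) {μ : ℝ} (hμ : 0 ≤ μ) :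
    ∃ u : ℕ → G.H1, (∀ n, G.mass (u n) = μ) ∧ Tendsto (fun n => G.kinetic (u n)) atTop (𝓝 0) := by
  obtain ⟨R, hR⟩ := (tendsto_cutSoliton_sq.2.eventually_ne Real.pi_ne_zero).exists
  set m := ∫ t in Ici 0, cutSoliton R t ^ 2
  have hm : 0 < m := (integral_nonneg fun _ => by positivity).lt_of_ne' hR
  have hscale : ∀ (g : ℝ → ℝ) (l : ℝ), 0 < l →
      ∫ t in Ici 0, g (l * t) ^ 2 = l⁻¹ * ∫ t in Ici 0, g t ^ 2 := by
    intro g l hl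
    rw [integral_Ici_eq_integral_Ioi, integral_Ici_eq_integral_Ioi,
      integral_comp_mul_left_Ioi (fun t => g t ^ 2) 0 hl, mul_zero, smul_eq_mul]
  have hscale' : ∀ (g : ℝ → ℝ) (l : ℝ), 0 < l → IntegrableOn (fun t => g t ^ 2) (Ici 0) →
      IntegrableOn (fun t => g (l * t) ^ 2) (Ici 0) := by
    intro g l hl hg
    rw [integrableOn_Ici_iff_integrableOn_Ioi] at hg ⊢
    rw [integrableOn_Ioi_comp_mul_left_iff (fun t => g t ^ 2) 0 hl, mul_zero]
    exact hg
  have key : ∀ n : ℕ, ∃ u : G.H1, G.mass u = μ ∧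
      G.kinetic u = μ / m * (1 / ((n : ℝ) + 1)) ^ 2 * ∫ t in Ici 0, cutSolitonDeriv R t ^ 2 := by
    intro n
    set l : ℝ := 1 / ((n : ℝ) + 1)
    have hl : 0 < l := by positivity
    -- Stretching by 1/l multiplies the mass by 1/l, and this amplitude restores it to μ. The
    -- kinetic energy is left with a factor l².
    set c : ℝ := √(l * (μ / m))
    have hc : c ^ 2 = l * (μ / m) := Real.sq_sqrt (by positivity)
    have hd := continuous_cutSolitonDeriv R
    obtain ⟨u, h2, h2', -⟩ := H1.exists_halfline (G := G) h (f := fun t => c * cutSoliton R (l * t))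
      (f' := fun t => c * (cutSolitonDeriv R (l * t) * l))
      (fun x => by
        have h1 := (hasDerivAt_cutSoliton R (l * x)).comp x ((hasDerivAt_id x).const_mul l)
        rw [mul_one] at h1
        exact h1.const_mul c) (by fun_prop) (by simp [cutSoliton])
      (by
        simp only [mul_pow]
        exact (hscale' _ l hl (tendsto_cutSoliton_sq.1 R)).const_mul _)
      (by
        simp only [mul_pow]
        exact ((hscale' _ l hl (tendsto_cutSolitonDeriv_sq.1 R)).mul_const _).const_mul _)
    refine ⟨u, ?_, ?_⟩
    · rw [h2]
      simp only [mul_pow]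
      rw [MeasureTheory.integral_const_mul, hscale _ l hl, hc]
      field_simp
      rfl
    · rw [h2']
      simp only [mul_pow]
      rw [MeasureTheory.integral_const_mul, MeasureTheory.integral_mul_const, hscale _ l hl, hc]
      field_simp
  choose u hu hu' using key
  refine ⟨u, hu, ?_⟩
  simp only [hu']
  simpa using (((tendsto_one_div_add_atTop_nhds_zero_nat (𝕜 := ℝ)).pow 2).const_mul
    (μ / m)).mul_const (∫ t in Ici 0, cutSolitonDeriv R t ^ 2)

end MetricGraph

/-! ### The critical mass and the ground state energy -/

theorem HasWeakDerivOn.const_smul {I : Set ℝ} {f g : ℝ → ℂ} (h : HasWeakDerivOn I f g) (c : ℝ) :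
    HasWeakDerivOn I (fun t => c • f t) fun t => c • g t := by
  intro φ hφ hc hs
  simp only [smul_comm _ c]
  rw [MeasureTheory.integral_smul, MeasureTheory.integral_smul, h φ hφ hc hs, smul_neg]

theorem massScale_mul_eq_pi : massScale * (Real.pi * √3 / 2) = Real.pi := by
  have h3 : √3 ^ 2 = 3 := Real.sq_sqrt (by norm_num)
  have h : massScale * √3 = 2 := by
    refine (sq_eq_sq₀ (mul_nonneg massScale_pos.le (by positivity)) (by norm_num)).1 ?_
    rw [mul_pow, massScale_sq, h3]
    norm_num
  linear_combination Real.pi / 2 * h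

namespace MetricGraph

variable {V E H : Type*} {G : MetricGraph V E H}

/-- A real multiple of an element of `H¹(𝒢)`. -/
def H1.smul (c : ℝ) (u : G.H1) : G.H1 where
  toFun e t := c • u.toFun e t
  weakDeriv e t := c • u.weakDeriv e t
  continuousOn e := (u.continuousOn e).const_smul c
  continuous_vertex := by
    obtain ⟨val, hval⟩ := u.continuous_vertex
    exact ⟨fun v => c • val v, fun e t v h => by rw [hval e t v h]⟩
  memLp e := (u.memLp e).const_smul c
  memLp_weakDeriv e := (u.memLp_weakDeriv e).const_smul c
  hasWeakDerivOn e := (u.hasWeakDerivOn e).const_smul c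

variable [Fintype E] [Fintype H]

theorem integral_norm_smul_pow (c : ℝ) (f : E ⊕ H → ℝ → ℂ) (n : ℕ) :
    (G.integral fun e t => ‖c • f e t‖ ^ n) = |c| ^ n * G.integral fun e t => ‖f e t‖ ^ n := by
  simp only [integral, norm_smul, mul_pow, MeasureTheory.integral_const_mul, Real.norm_eq_abs,
    Finset.mul_sum]

theorem integral_norm_pow_nonneg (f : E ⊕ H → ℝ → ℂ) (n : ℕ) :
    0 ≤ G.integral fun e t => ‖f e t‖ ^ n :=
  Finset.sum_nonneg fun _ _ => integral_nonneg fun _ => by positivity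

/-- The Gagliardo-Nirenberg inequality with the best constant of the line. -/
theorem HasCycleCovering.sextic_le [Nonempty H] (hH : G.HasCycleCovering) (hconn : G.Connected)
    (u : G.H1) : G.sextic u ≤ 4 / Real.pi ^ 2 * (G.mass u ^ 2 * G.kinetic u) := by
  rcases (integral_norm_pow_nonneg (G := G) u.toFun 2).eq_or_lt' with hm | hm
  · have hz : ∀ e, ∀ t ∈ G.interval e, u.toFun e t = 0 := fun e =>
      u.eq_zero_of_setIntegral_eq_zero e ((Finset.sum_eq_zero_iff_of_nonneg
        fun e _ => MeasureTheory.integral_nonneg fun _ => by positivity).1 hm e (Finset.mem_univ e))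
    have h6 : G.sextic u = 0 := Finset.sum_eq_zero fun e _ =>
      setIntegral_eq_zero_of_forall_eq_zero fun t ht => by simp [hz e t ht]
    rw [h6]
    have := integral_norm_pow_nonneg (G := G) u.weakDeriv 2
    exact mul_nonneg (by positivity) (mul_nonneg (sq_nonneg _) this)
  · change 0 < G.mass u at hm
    -- Rescaling to the critical mass, where nonnegative energy says c⁴‖u‖₆⁶ ≤ 3‖u'‖₂²; inserting c⁴
    -- = 3π²/(4‖u‖₂⁴) gives the constant 4/π².
    set c : ℝ := √(Real.pi * √3 / 2 / G.mass u)
    have hc : c ^ 2 = Real.pi * √3 / 2 / G.mass u := Real.sq_sqrt (by positivity)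
    have hpi := Real.pi_pos
    have hc0 : 0 < c := Real.sqrt_pos.2 (by positivity)
    have hmass : G.mass (u.smul c) = c ^ 2 * G.mass u := by
      rw [← sq_abs c]
      exact integral_norm_smul_pow c u.toFun 2
    have hkin : G.kinetic (u.smul c) = c ^ 2 * G.kinetic u := by
      rw [← sq_abs c]
      exact integral_norm_smul_pow c u.weakDeriv 2
    have hsex : G.sextic (u.smul c) = c ^ 6 * G.sextic u := by
      have := integral_norm_smul_pow (G := G) c u.toFun 6
      rwa [abs_of_pos hc0] at this
    have h := (hH.energy_nonneg hconn (u := u.smul c) (by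
      rw [hmass, hc, div_mul_cancel₀ _ hm.ne', massScale_mul_eq_pi])).1
    rw [energy, hkin, hsex] at h
    have h1 : (c ^ 2) ^ 2 * G.sextic u ≤ 3 * G.kinetic u := by
      refine le_of_mul_le_mul_left ?_ (pow_pos hc0 2)
      linarith
    have h3 : √3 ^ 2 = 3 := Real.sq_sqrt (by norm_num)
    rw [hc, div_pow, div_pow, mul_pow, h3] at h1
    field_simp at h1 ⊢
    linarith

/-- The best constant is that of the line. -/
theorem HasCycleCovering.bestConstant_eq [Nonempty H] (hH : G.HasCycleCovering)
    (hconn : G.Connected) : G.bestConstant = 4 / Real.pi ^ 2 := by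
  obtain ⟨u, hu, hlim⟩ := exists_tendsto_quotient (G := G) (Classical.arbitrary H)
  have hub : ∀ r ∈ {r | ∃ u : G.H1, G.mass u ≠ 0 ∧ r = G.sextic u / (G.mass u ^ 2 * G.kinetic u)},
      r ≤ 4 / Real.pi ^ 2 := by
    rintro r ⟨v, -, rfl⟩
    have h2 := integral_norm_pow_nonneg (G := G) v.weakDeriv 2
    exact div_le_of_le_mul₀ (mul_nonneg (sq_nonneg _) h2) (by positivity) (hH.sextic_le hconn v)
  refine le_antisymm (csSup_le ?_ hub) ?_
  · obtain ⟨R, hR⟩ := hu.exists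
    exact ⟨_, u R, hR, rfl⟩
  · exact le_of_tendsto hlim (hu.mono fun R hR => le_csSup ⟨_, hub⟩ ⟨u R, hR, rfl⟩)

theorem HasCycleCovering.criticalMass_eq [Nonempty H] (hH : G.HasCycleCovering)
    (hconn : G.Connected) : G.criticalMass = Real.pi * √3 / 2 := by
  have hpi := Real.pi_pos
  rw [criticalMass, hH.bestConstant_eq hconn, Real.sqrt_eq_iff_mul_self_eq (by positivity)
    (by positivity)]
  have h3 : √3 ^ 2 = 3 := Real.sq_sqrt (by norm_num)
  field_simp
  rw [h3]
  norm_num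

/-- The lower bound is the main estimate. For the upper bound, the energy is at most half the
kinetic term, which vanishes along functions spread over a halfline. -/
theorem HasCycleCovering.groundEnergy_eq_zero [Nonempty H] (hH : G.HasCycleCovering)
    (hconn : G.Connected) : G.groundEnergy (Real.pi * √3 / 2) = 0 := by
  refine le_antisymm ?_ (le_iInf fun u => ?_)
  · obtain ⟨u, hu, hlim⟩ := exists_tendsto_kinetic (G := G) (Classical.arbitrary H)
      (μ := Real.pi * √3 / 2) (by positivity)
    have h1 : Tendsto (fun n => ((G.kinetic (u n) : ℝ) : EReal)) atTop (𝓝 0) :=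
      (continuous_coe_real_ereal.tendsto 0).comp hlim
    refine ge_of_tendsto' h1 fun n => (iInf_le _ ⟨u n, hu n⟩).trans ?_
    rw [EReal.coe_le_coe_iff, energy]
    have h2 := integral_norm_pow_nonneg (G := G) (u n).weakDeriv 2
    have h6 := integral_norm_pow_nonneg (G := G) (u n).toFun 6
    change 0 ≤ G.kinetic (u n) at h2
    change 0 ≤ G.sextic (u n) at h6
    linarith
  · rw [EReal.coe_nonneg]
    exact (hH.energy_nonneg hconn (by rw [u.2, massScale_mul_eq_pi])).1

end MetricGraph

/-! ### The real line as a special case -/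

theorem realLine_connected : realLine.Connected := fun v w =>
  Subsingleton.elim v w ▸ .refl v

theorem realLine_hasCycleCovering : realLine.HasCycleCovering := by
  rintro (e | h)
  · exact e.elim
  -- Once their ends at infinity are identified, the two halflines are parallel edges and form a
  -- cycle of length two; it is numbered so that the given halfline comes first.
  · refine ⟨2, fun i => if i = 0 then none else some (), fun i => if i = 0 then .inr h else .inr !h,
      ⟨one_le_two, by decide, ?_, ?_⟩, 0, if_pos rfl⟩
    · cases h <;> decide
    · intro i
      have : i = 0 ∨ i = 1 := by revert i; decide
      rcases this with rfl | rfl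
      · exact .inr ⟨rfl, rfl⟩
      · exact .inl ⟨rfl, rfl⟩

theorem criticalMassReal_eq : criticalMassReal = Real.pi * √3 / 2 :=
  realLine_hasCycleCovering.criticalMass_eq realLine_connected

end

theorem theorem7p2 {V E H : Type*} [Finite V] [Fintype E] [Fintype H] [Nonempty H]
    (G : MetricGraph V E H) (hconn : G.Connected) (hH : G.HasCycleCovering) :
    G.criticalMass = criticalMassReal ∧
      G.groundEnergy criticalMassReal = 0 ∧
      ((∃ u : G.H1, G.IsGroundState criticalMassReal u) ↔
        (G.IsRealLine ∨ G.IsTowerOfBubbles)) := by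
  rw [criticalMassReal_eq]
  have h0 := hH.groundEnergy_eq_zero hconn
  refine ⟨hH.criticalMass_eq hconn, h0, ?_, ?_⟩
  · rintro ⟨u, hm, hE⟩
    refine (hH.energy_nonneg hconn (u := u) (by rw [hm, massScale_mul_eq_pi])).2 ?_
    rw [h0] at hE
    exact_mod_cast hE
  · intro h
    obtain ⟨u, hm, hE⟩ : ∃ u : G.H1, G.mass u = Real.pi * √3 / 2 ∧ G.energy u = 0 := by
      rcases h with h | ⟨S, -, -, h⟩
      · exact h.exists_energy_eq_zero
      · exact h.exists_energy_eq_zero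
    exact ⟨u, hm, by rw [h0, hE, EReal.coe_zero]⟩
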